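/- **Setting.** Let $(\Omega,\mathcal H,\overline{\mathbf E})$ be a sublinear expectation space: $\mathcal H$ is a linear space of functions $\Omega\to\mathbb R$ containing the constants, and $\overline{\mathbf E}:\mathcal H\to\mathbb R$ is monotone, preserves constants, is sub-additive and positively homogeneous. Put $\underline{\mathbf E}[X]=-\overline{\mathbf E}[-X]$. For an arbitrary function $F:\Omega\to\mathbb R$ not in $\mathcal H$, put $\overline{\mathbf E}[F]=\inf\{\overline{\mathbf E}[Z]: Z\in\mathcal H,\ Z\ge F\}\in(-\infty,\infty]$ whenever $F\ge 0$ (with $\inf\emptyset=\infty$; this agrees with $\overline{\mathbf E}[F]$ if $F\in\mathcal H$). A random vector $\vec Y\in\mathbb R^l$ is *independent to* $\vec X\in\mathbb R^m$ if, for all bounded continuous $\psi:\mathbb R^{m+l}\to\mathbb R$, $\psi(\vec X,\vec Y)\in\mathcal H$ and $\overline{\mathbf E}[\psi(\vec X,\vec Y)]=\overline{\mathbf E}\big[\overline{\mathbf E}[\psi(\vec x,\vec Y)]|_{\vec x=\vec X}\big]$ (all variables under $\overline{\mathbf E}$ being in $\mathcal H$). Let $X_1,X_2,\dots$ be i.i.d.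 with $X_0$: for each $k\ge2$, $X_k$ is independent to $\vec X_{k-1}=(X_1,\dots,X_{k-1})$, and for each $k\ge1$ and all bounded continuous $\psi$, $\psi(X_k),\psi(X_0)\in\mathcal H$ and $\overline{\mathbf E}[\psi(X_k)]=\overline{\mathbf E}[\psi(X_0)]$. Suppose $X_0,X_0^2\in\mathcal H$, and put $\underline\mu=\underline{\mathbf E}[X_0]$, $\overline\mu=\overline{\mathbf E}[X_0]$ and, for $\mu\in[\underline\mu,\overline\mu]$, $\underline\sigma(\mu)=\underline{\mathbf E}[(X_0-\mu)^2]^{1/2}$, $\overline\sigma(\mu)=\overline{\mathbf E}[(X_0-\mu)^2]^{1/2}$. Assume $$0<\underline\sigma:=\inf_{\mu\in[\underline\mu,\overline\mu]}\underline\sigma(\mu)\le\overline\sigma:=\sup_{\mu\in[\underline\mu,\overline\mu]}\overline\sigma(\mu)<\infty .$$ For $p\ge2$ and $C>0$ let $\xi_0(\mu)=(X_0-\mu)/\underline\sigma(\mu)$, $$\gamma_p(C)=\sup_{\mu\in[\underline\mu,\overline\mu]}\overline{\mathbf E}\big[\min\{|\xi_0(\mu)|^p,\ C^{p-2}\xi_0(\mu)^2\}\big],\qquad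 \gamma_p=\sup_{\mu\in[\underline\mu,\overline\mu]}\overline{\mathbf E}\big[|\xi_0(\mu)|^p\big]\le\infty .$$ For $n\ge1$ let $\mathcal M_n$ be the set of all sequences $\{(\mu_i,\sigma_i)\}_{i=1}^n$ of pairs of continuous functions of $\vec X_{i-1}$ (constants for $i=1$) satisfying $$\underline\mu\le\mu_i\le\overline\mu,\qquad 0<\underline\sigma\le\underline\sigma(\mu_i)\le\sigma_i\le\overline\sigma(\mu_i)\le\overline\sigma .$$ For such a sequence let $S_n$ be the random continuous broken line on $[0,1]$, linear on each $[\frac{k-1}n,\frac kn]$, with $S_n(\frac kn)=\frac1{\sqrt n}\sum_{i=1}^k\frac{X_i-\mu_i}{\sigma_i}$, $k=0,\dots,n$. For $D\subset C[0,1]$ put $$\overline{\mathbf P}(S_n\in D)=\inf\{\overline{\mathbf E}\,\psi(\vec X_n):\ \psi(\vec X_n)\ge \mathbf I(S_n\in D),\ \psi(\vec X_n)\in\mathcal H\},$$ where $\vec X_n=(X_1,\dots,X_n)$ and $\psi$ ranges over functions $\mathbb R^n\to\mathbb R$; let $D^\varepsilon$ be the open $\varepsilon$-neighbourhood of $D$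 in the uniform norm, and let $B$ be a standard Wiener process on a classical probability space with probability $\mathbf P$. **Theorem 2.1.** Under these assumptions, for every $n\ge1$, every set $D\subset C[0,1]$ (not necessarily measurable) and every $\varepsilon>0$ there exist $\{(\mu_i,\sigma_i)\}\in\mathcal M_n$, depending on $D,\varepsilon,n$, such that for all $p\in[2,3]$ $$\overline{\mathbf P}(S_n\in D)-\mathbf P(B\in D^\varepsilon)\ \le\ \frac{C_2(p)\,\gamma_p(\varepsilon\sqrt n)}{n^{(p-2)/2}\varepsilon^p}\ \le\ \frac{C_2(p)\,\gamma_p}{n^{(p-2)/2}\varepsilon^p},\qquad C_2(p)=\min\{184,\,4.7^{\,p+1}\}.$$ -/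

import Mathlib

open scoped BoundedContinuousFunction

noncomputable section

/-- A sublinear expectation space `(Ω, H, 𝔼)`: `dom` is the linear space `H` of random variables and
`E` is the functional on it.  All laws concern elements of `dom` only, and `E` is only ever evaluated
below at functions which are required (or follow) to belong to `dom`. -/
structure SublinearExpectation (Ω : Type*) where
  dom : Submodule ℝ (Ω → ℝ)
  E : (Ω → ℝ) → ℝ
  const_mem : ∀ c : ℝ, (fun _ => c) ∈ dom
  mono : ∀ X ∈ dom, ∀ Y ∈ dom, (∀ ω, X ω ≤ Y ω) → E X ≤ E Y
  const : ∀ c : ℝ, E (fun _ => c) = c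
  subadd : ∀ X ∈ dom, ∀ Y ∈ dom, E (X + Y) ≤ E X + E Y
  pos_homog : ∀ X ∈ dom, ∀ c : ℝ, 0 ≤ c → E (c • X) = c * E X

namespace SublinearExpectation

variable {Ω : Type*} (𝔼 : SublinearExpectation Ω)

/-- `Y` is independent to `X` : for every bounded continuous `ψ`, `ψ(X, Y) ∈ H` and
`𝔼[ψ(X, Y)] = 𝔼[ 𝔼[ψ(x, Y)] |_{x = X} ]`, where the variables occurring under the inner and the outer
expectation on the right belong to `H`. -/
def IsIndepTo {α β : Type*} [TopologicalSpace α] [TopologicalSpace β]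
    (Y : Ω → β) (X : Ω → α) : Prop :=
  ∀ ψ : (α × β) →ᵇ ℝ,
    (fun ω => ψ (X ω, Y ω)) ∈ 𝔼.dom ∧
    (∀ x : α, (fun ω => ψ (x, Y ω)) ∈ 𝔼.dom) ∧
    (fun ω => 𝔼.E (fun ω' => ψ (X ω, Y ω'))) ∈ 𝔼.dom ∧
    𝔼.E (fun ω => ψ (X ω, Y ω)) = 𝔼.E (fun ω => 𝔼.E (fun ω' => ψ (X ω, Y ω')))

/-- `Y` is distributed identically with `X₀`: `𝔼[ψ(Y)] = 𝔼[ψ(X₀)]` for bounded continuous `ψ`. -/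
def IsIdentDistrib (Y X₀ : Ω → ℝ) : Prop :=
  ∀ ψ : ℝ →ᵇ ℝ,
    (fun ω => ψ (Y ω)) ∈ 𝔼.dom ∧ (fun ω => ψ (X₀ ω)) ∈ 𝔼.dom ∧
    𝔼.E (fun ω => ψ (Y ω)) = 𝔼.E (fun ω => ψ (X₀ ω))

/-- The sequence `X₁, X₂, …` (here `X 0, X 1, …`) is i.i.d. with `X₀`. -/
def IsIIDWith (X : ℕ → Ω → ℝ) (X₀ : Ω → ℝ) : Prop :=
  (∀ k, 𝔼.IsIdentDistrib (X k) X₀) ∧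
  ∀ k, 1 ≤ k → 𝔼.IsIndepTo (X k) (fun ω (j : Fin k) => X j ω)

/-- The lower expectation `-𝔼[-X]`. -/
def lowerE (X : Ω → ℝ) : ℝ := -𝔼.E (-X)

/-- The interval `[-𝔼[-X₀], 𝔼[X₀]]` of possible means. -/
def meanInterval (X₀ : Ω → ℝ) : Set ℝ := Set.Icc (𝔼.lowerE X₀) (𝔼.E X₀)

/-- The lower standard deviation about `μ`. -/
def lowerSD (X₀ : Ω → ℝ) (μ : ℝ) : ℝ := √(𝔼.lowerE (fun ω => (X₀ ω - μ) ^ 2))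

/-- The upper standard deviation about `μ`. -/
def upperSD (X₀ : Ω → ℝ) (μ : ℝ) : ℝ := √(𝔼.E (fun ω => (X₀ ω - μ) ^ 2))

/-- Infimum of the lower standard deviations over the interval of means. -/
def lowerSigma (X₀ : Ω → ℝ) : ℝ := sInf (𝔼.lowerSD X₀ '' 𝔼.meanInterval X₀)

/-- Supremum of the upper standard deviations over the interval of means (see
`nonempty_meanInterval` and `bddAbove_upperSD` for non-emptiness and boundedness). -/
def upperSigma (X₀ : Ω → ℝ) : ℝ := sSup (𝔼.upperSD X₀ '' 𝔼.meanInterval X₀)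

/-- The upper extension of `𝔼` to arbitrary functions: the infimum of `𝔼[Z]` over `Z ∈ H` with
`F ≤ Z`; it is `⊤` if there is no such `Z`. -/
def extE (F : Ω → ℝ) : EReal :=
  ⨅ Z ∈ {Z : Ω → ℝ | Z ∈ 𝔼.dom ∧ ∀ ω, F ω ≤ Z ω}, ((𝔼.E Z : ℝ) : EReal)

/-- `ξ₀(μ) = (X₀ - μ) / lowerSD(μ)`. -/
def xi₀ (X₀ : Ω → ℝ) (μ : ℝ) (ω : Ω) : ℝ := (X₀ ω - μ) / 𝔼.lowerSD X₀ μ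

/-- The truncated moment `γ_p(C) = sup_μ 𝔼[ min(|ξ₀(μ)|^p, C^(p-2) ξ₀(μ)^2) ]`. -/
def gammaTrunc (X₀ : Ω → ℝ) (p C : ℝ) : EReal :=
  ⨆ μ ∈ 𝔼.meanInterval X₀,
    𝔼.extE (fun ω => min (|𝔼.xi₀ X₀ μ ω| ^ p) (C ^ (p - 2) * 𝔼.xi₀ X₀ μ ω ^ 2))

/-- The moment `γ_p = sup_μ 𝔼[ |ξ₀(μ)|^p ]`, possibly infinite. -/
def gamma (X₀ : Ω → ℝ) (p : ℝ) : EReal :=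
  ⨆ μ ∈ 𝔼.meanInterval X₀, 𝔼.extE (fun ω => |𝔼.xi₀ X₀ μ ω| ^ p)

/-- The upper probability of an event `A` in terms of the random vector `V`: the infimum of
`𝔼[ψ(V)]` over all functions `ψ` with `ψ(V) ∈ H` and `ψ(V) ≥ I(A)`.  The set of these values is
bounded below by `0` and contains `1`, see `upperProb_nonneg` and `upperProb_le_one`. -/
def upperProb {α : Type*} (V : Ω → α) (A : Set Ω) : ℝ :=
  sInf {r : ℝ | ∃ ψ : α → ℝ, (fun ω => ψ (V ω)) ∈ 𝔼.dom ∧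
    (∀ ω, A.indicator (fun _ => (1 : ℝ)) ω ≤ ψ (V ω)) ∧ 𝔼.E (fun ω => ψ (V ω)) = r}

/-- The pairs `(μ_i, σ_i)`, `i = 1, …, n` (numbered here by `i : Fin n`, so that the index `i`
stands for the `(i+1)`-st pair, a pair of functions of the first `i` observations), are continuous
and satisfy
`μ̲ ≤ μ_i ≤ μ̄` and `0 < σ̲ ≤ σ̲(μ_i) ≤ σ_i ≤ σ̄(μ_i) ≤ σ̄`. -/
structure IsAdmissible (X₀ : Ω → ℝ) (n : ℕ)
    (m s : (i : Fin n) → (Fin i → ℝ) → ℝ) : Prop where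
  continuous_m : ∀ i, Continuous (m i)
  continuous_s : ∀ i, Continuous (s i)
  m_mem : ∀ i x, m i x ∈ 𝔼.meanInterval X₀
  lowerSigma_pos : 0 < 𝔼.lowerSigma X₀
  lowerSigma_le : ∀ i x, 𝔼.lowerSigma X₀ ≤ 𝔼.lowerSD X₀ (m i x)
  lowerSD_le : ∀ i x, 𝔼.lowerSD X₀ (m i x) ≤ s i x
  le_upperSD : ∀ i x, s i x ≤ 𝔼.upperSD X₀ (m i x)
  upperSD_le : ∀ i x, 𝔼.upperSD X₀ (m i x) ≤ 𝔼.upperSigma X₀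

/-! ### Well-posedness of the definitions above -/

variable {𝔼}

lemma nonempty_meanInterval {X₀ : Ω → ℝ} (h : X₀ ∈ 𝔼.dom) : (𝔼.meanInterval X₀).Nonempty := by
  have h1 := 𝔼.subadd X₀ h (-X₀) (𝔼.dom.neg_mem h)
  have h2 : 𝔼.E (X₀ + -X₀) = 0 := by
    rw [add_neg_cancel]; exact 𝔼.const 0
  rw [meanInterval, Set.nonempty_Icc, lowerE]
  linarith

lemma sq_sub_mem {X₀ : Ω → ℝ} (h : X₀ ∈ 𝔼.dom) (h2 : (fun ω => X₀ ω ^ 2) ∈ 𝔼.dom) (μ : ℝ) :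
    (fun ω => (X₀ ω - μ) ^ 2) ∈ 𝔼.dom := by
  have := 𝔼.dom.add_mem (𝔼.dom.add_mem h2 (𝔼.dom.smul_mem (-2 * μ) h)) (𝔼.const_mem (μ ^ 2))
  convert this using 1
  funext ω
  simp only [Pi.add_apply, Pi.smul_apply, smul_eq_mul]
  ring

lemma bddAbove_upperSD {X₀ : Ω → ℝ} (h : X₀ ∈ 𝔼.dom) (h2 : (fun ω => X₀ ω ^ 2) ∈ 𝔼.dom) :
    BddAbove (𝔼.upperSD X₀ '' 𝔼.meanInterval X₀) := by
  set M : ℝ := max |𝔼.lowerE X₀| |𝔼.E X₀| with hM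
  have hq : ((2 : ℝ) • (fun ω => X₀ ω ^ 2) + fun _ => 2 * M ^ 2) ∈ 𝔼.dom :=
    𝔼.dom.add_mem (𝔼.dom.smul_mem 2 h2) (𝔼.const_mem _)
  refine ⟨√(𝔼.E ((2 : ℝ) • (fun ω => X₀ ω ^ 2) + fun _ => 2 * M ^ 2)), ?_⟩
  rintro _ ⟨μ, hμ, rfl⟩
  refine Real.sqrt_le_sqrt (𝔼.mono _ (sq_sub_mem h h2 μ) _ hq fun ω => ?_)
  have hμM : μ ^ 2 ≤ M ^ 2 := by
    apply sq_le_sq'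
    · have := neg_abs_le (𝔼.lowerE X₀)
      have := le_max_left |𝔼.lowerE X₀| |𝔼.E X₀|
      linarith [hμ.1]
    · have := le_abs_self (𝔼.E X₀)
      have := le_max_right |𝔼.lowerE X₀| |𝔼.E X₀|
      linarith [hμ.2]
  simp only [Pi.add_apply, Pi.smul_apply, smul_eq_mul]
  nlinarith [sq_nonneg (X₀ ω + μ)]

lemma upperProb_nonneg {α : Type*} (V : Ω → α) (A : Set Ω) : 0 ≤ 𝔼.upperProb V A := by
  refine Real.sInf_nonneg ?_
  rintro r ⟨ψ, hψ, hA, rfl⟩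
  rw [← 𝔼.const 0]
  exact 𝔼.mono _ (𝔼.const_mem 0) _ hψ fun ω =>
    (Set.indicator_nonneg (fun _ _ => zero_le_one) ω).trans (hA ω)

lemma upperProb_le_one {α : Type*} (V : Ω → α) (A : Set Ω) : 𝔼.upperProb V A ≤ 1 := by
  refine csInf_le ⟨0, ?_⟩ ⟨fun _ => 1, 𝔼.const_mem 1, fun ω => ?_, 𝔼.const 1⟩
  · rintro r ⟨ψ, hψ, hA, rfl⟩
    rw [← 𝔼.const 0]
    exact 𝔼.mono _ (𝔼.const_mem 0) _ hψ fun ω =>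
      (Set.indicator_nonneg (fun _ _ => zero_le_one) ω).trans (hA ω)
  · exact Set.indicator_le_self' (fun _ _ => zero_le_one) ω

end SublinearExpectation

/-- The continuous broken line on `[0,1]` with vertices at `k/n`, `k = 0, …, n`, and value
`(x₁ + … + x_k) / √n` at `k/n`. -/
def brokenLine (n : ℕ) (x : Fin n → ℝ) : C(unitInterval, ℝ) where
  toFun t := (√(n : ℝ))⁻¹ * ∑ i : Fin n, x i * max 0 (min 1 (n * (t : ℝ) - (i : ℕ)))
  continuous_toFun := by fun_prop

/-- On `[k/n, (k+1)/n]` the broken line is the linear interpolation of the partial sums. -/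
lemma brokenLine_apply (n : ℕ) (x : Fin n → ℝ) (k : Fin n) (t : unitInterval)
    (h0 : (k : ℕ) ≤ n * (t : ℝ)) (h1 : n * (t : ℝ) ≤ (k : ℕ) + 1) :
    brokenLine n x t =
      (√(n : ℝ))⁻¹ * (∑ i ∈ Finset.Iio k, x i + (n * (t : ℝ) - (k : ℕ)) * x k) := by
  have key : ∀ i : Fin n, x i * max 0 (min 1 (n * (t : ℝ) - (i : ℕ))) =
      (if i < k then x i else 0) + (if i = k then (n * (t : ℝ) - (k : ℕ)) * x k else 0) := by
    intro i
    rcases lt_trichotomy i k with h | h | h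
    · have : ((i : ℕ) : ℝ) + 1 ≤ (k : ℕ) := by exact_mod_cast h
      rw [if_pos h, if_neg h.ne, min_eq_left (by linarith), max_eq_right zero_le_one]
      ring
    · subst h
      rw [if_neg (lt_irrefl _), if_pos rfl, min_eq_right (by linarith),
        max_eq_right (by linarith)]
      ring
    · have : ((k : ℕ) : ℝ) + 1 ≤ (i : ℕ) := by exact_mod_cast h
      rw [if_neg h.not_gt, if_neg h.ne', max_eq_left (min_le_of_right_le (by linarith))]
      ring
  change (√(n : ℝ))⁻¹ * ∑ i : Fin n, x i * max 0 (min 1 (n * (t : ℝ) - (i : ℕ))) = _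
  rw [Finset.sum_congr rfl fun i _ => key i, Finset.sum_add_distrib, ← Finset.sum_filter]
  congr 2
  · congr 1
    ext i
    simp
  · simp

/-- The random broken line `S_n` with the values `n^{-1/2} ∑_{i ≤ k} (X_i - μ_i) / σ_i` at `k/n`,
where `μ_i`, `σ_i` are evaluated at the preceding observations `(X_1, …, X_{i-1})`. -/
def adaptiveLine {Ω : Type*} (X : ℕ → Ω → ℝ) (n : ℕ) (m s : (i : Fin n) → (Fin i → ℝ) → ℝ)
    (ω : Ω) : C(unitInterval, ℝ) :=
  brokenLine n fun i =>
    (X i ω - m i (fun j : Fin i => X j ω)) / s i (fun j : Fin i => X j ω)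

/-- The event that the path on `[0,1]` of the process `B` is (a continuous function) in `A`. -/
def pathEvent {Ω' : Type*} (B : NNReal → Ω' → ℝ) (A : Set C(unitInterval, ℝ)) : Set Ω' :=
  {ω | ∃ f ∈ A, ∀ t : unitInterval, f t = B (unitInterval.toNNReal t) ω}

/-- `C₂(p) = min {184, 4.7^(p+1)}`. -/
def constC₂ (p : ℝ) : ℝ := min 184 ((4.7 : ℝ) ^ (p + 1))

end

/-! The proof is a Lindeberg replacement played as a control problem. Put `C = ε √n` and rescale
time and space so that Brownian motion has unit variance per step. The potential at time `k` is the
smoothed probability that the path which follows the standardized sums up to time `k` and Brownian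
increments afterwards lands in a tube around the admissible vertex sequences (`tubePotential`). It
equals 1 at time `n` on the event in question. At time 0 it is at most the probability that the
Brownian skeleton is close to the vertices of a path of `D`.

Smoothing is by three sliding averages of width `h`, so Taylor's formula holds to third order for a
merely continuous function (`tripleAverage_taylor`). The averages displace the current position by
at most `3h/2`. The tube demands exact agreement before time `k` and closeness `κ ≥ 3h/2` from then
on, so every displacement is absorbed by the tolerance at its own coordinate and displacements never
accumulate (`tubeIndicator_succ_le`, `integral_tubeValue_succ_le`).

One step (`tubePotential_succ_le`) changes the potential by at most `a y + b (y² - 1)/2` plus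
remainders, where `y` is the standardized increment and `a`, `b` depend on the past. Choosing an
extreme mean according to the sign of `a`, and an extreme variance about it according to the sign of
`b`, makes the upper expectation of this quadratic zero. Interpolating near sign changes keeps the
choice continuous at an arbitrarily small cost (`exists_selection`). Iterating over the i.i.d.
sequence (`E_iterate_le`) adds the remainders, which truncated moments control
(`taylor_remainder_le`).

It remains to pass from the skeleton to the whole Brownian path (`measureReal_skeleton_le`). This
costs the probability that one of `n` Brownian bridges is large, bounded through linear barriers
(`measure_crossing_le`). The choice of means and deviations uses only `D`, `ε`, `n`; the exponent
`p` enters afterwards, in estimating the remainder. Lower bounds for the truncated moment let the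
other errors be absorbed in it and settle the range where the claim is trivial. -/

open MeasureTheory ProbabilityTheory Filter Topology

/-! ### Averaging over a sliding window -/

/-- The average of `F` over the window of width `h` centred at `y`. -/
noncomputable def slidingAverage (h : ℝ) (F : ℝ → ℝ) (y : ℝ) : ℝ :=
  ∫ t in (-1 / 2 : ℝ)..(1 / 2), F (y + h * t)

/-- By the fundamental theorem of calculus, each average trades one derivative for a difference
quotient. Hence bounds on derivatives need only bounds on `F`. -/
lemma hasDerivAt_slidingAverage {h : ℝ} (hh : h ≠ 0) {F : ℝ → ℝ} (hF : Continuous F) (y : ℝ) :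
    HasDerivAt (slidingAverage h F) ((F (y + h / 2) - F (y - h / 2)) / h) y := by
  have hI : ∀ x, HasDerivAt (fun u => ∫ v in (0 : ℝ)..u, F v) (F x) x := fun x =>
    intervalIntegral.integral_hasDerivAt_right (hF.intervalIntegrable _ _)
      (hF.stronglyMeasurableAtFilter _ _) hF.continuousAt
  have key : slidingAverage h F = fun y =>
      ((∫ v in (0 : ℝ)..(y + h / 2), F v) - ∫ v in (0 : ℝ)..(y - h / 2), F v) / h := by
    funext y
    rw [slidingAverage, intervalIntegral.integral_comp_add_mul _ hh,
      intervalIntegral.integral_interval_sub_left (hF.intervalIntegrable _ _)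
        (hF.intervalIntegrable _ _), smul_eq_mul, div_eq_inv_mul _ h,
      show y + h * (-1 / 2) = y - h / 2 by ring, show y + h * (1 / 2) = y + h / 2 by ring]
  rw [key]
  have h1 := (hI (y + h / 2)).comp_add_const y (h / 2)
  have h2 := (hI (y - h / 2)).comp_sub_const y (h / 2)
  exact (h1.sub h2).div_const h

lemma continuous_slidingAverage (h : ℝ) {α : Type*} [TopologicalSpace α]
    {F : α → ℝ → ℝ} (hF : Continuous (Function.uncurry F)) :
    Continuous (Function.uncurry fun a => slidingAverage h (F a)) := by
  unfold slidingAverage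
  apply intervalIntegral.continuous_parametric_intervalIntegral_of_continuous'
  exact hF.comp (f := fun q : (α × ℝ) × ℝ => (q.1.1, q.1.2 + h * q.2)) (by fun_prop)

lemma continuous_slidingAverage_apply (h : ℝ) {F : ℝ → ℝ} (hF : Continuous F) :
    Continuous (slidingAverage h F) := by
  unfold slidingAverage
  apply intervalIntegral.continuous_parametric_intervalIntegral_of_continuous'
  exact hF.comp (f := fun q : ℝ × ℝ => q.1 + h * q.2) (by fun_prop)

lemma slidingAverage_const (h c : ℝ) : slidingAverage h (fun _ => c) = fun _ => c := by
  funext y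
  rw [slidingAverage, intervalIntegral.integral_const]
  norm_num

/-- An average sees only its window, so a comparison near `c` suffices; each average costs `h / 2`
of the radius. -/
lemma slidingAverage_le {h r c : ℝ} (hh : 0 ≤ h) {F F' : ℝ → ℝ} (hF : Continuous F)
    (hF' : Continuous F') (hle : ∀ y, |y - c| ≤ r + h / 2 → F y ≤ F' y) {y : ℝ}
    (hy : |y - c| ≤ r) : slidingAverage h F y ≤ slidingAverage h F' y := by
  refine intervalIntegral.integral_mono_on (by norm_num)
    ((by fun_prop : Continuous fun t => F (y + h * t)).intervalIntegrable _ _)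
    ((by fun_prop : Continuous fun t => F' (y + h * t)).intervalIntegrable _ _) fun t ht => hle _ ?_
  have h1 : |h * t| ≤ h / 2 := by
    rw [abs_mul, abs_of_nonneg hh, div_eq_mul_inv]
    refine mul_le_mul_of_nonneg_left (abs_le.2 ⟨?_, ?_⟩) hh
    · linarith [ht.1]
    · linarith [ht.2]
  calc |y + h * t - c| = |(y - c) + h * t| := by ring_nf
    _ ≤ |y - c| + |h * t| := abs_add_le _ _
    _ ≤ r + h / 2 := add_le_add hy h1

lemma slidingAverage_mem_Icc (h : ℝ) {F : ℝ → ℝ} (hF : Continuous F)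
    (h01 : ∀ y, F y ∈ Set.Icc (0 : ℝ) 1) (y : ℝ) : slidingAverage h F y ∈ Set.Icc (0 : ℝ) 1 := by
  have hi : IntervalIntegrable (fun t => F (y + h * t)) volume (-1 / 2) (1 / 2) :=
    (by fun_prop : Continuous fun t => F (y + h * t)).intervalIntegrable _ _
  have hc : ∀ c : ℝ, ∫ _ in (-1 / 2 : ℝ)..(1 / 2), c = c := fun c => by
    rw [intervalIntegral.integral_const]; norm_num
  constructor
  · rw [← hc 0]
    exact intervalIntegral.integral_mono_on (by norm_num) (by simp) hi fun t _ => (h01 _).1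
  · rw [← hc 1]
    exact intervalIntegral.integral_mono_on (by norm_num) hi (by simp) fun t _ => (h01 _).2

lemma integral_slidingAverage {h : ℝ} {F : ℝ → ℝ} (hF : Continuous F)
    (h01 : ∀ y, F y ∈ Set.Icc (0 : ℝ) 1) (μ : Measure ℝ) [IsProbabilityMeasure μ] (y : ℝ) :
    ∫ z, slidingAverage h F (y + z) ∂μ = slidingAverage h (fun v => ∫ z, F (v + z) ∂μ) y := by
  simp only [slidingAverage]
  have : IsFiniteMeasure (volume.restrict (Set.uIoc (-1 / 2 : ℝ) (1 / 2))) :=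
    ⟨by simp [Set.uIoc]⟩
  have hint : Integrable (Function.uncurry fun (t z : ℝ) => F (y + z + h * t))
      ((volume.restrict (Set.uIoc (-1 / 2 : ℝ) (1 / 2))).prod μ) := by
    refine Integrable.of_bound (C := 1) ?_ (ae_of_all _ fun p => ?_)
    · exact (hF.comp (f := fun p : ℝ × ℝ => y + p.2 + h * p.1) (by fun_prop)).aestronglyMeasurable
    · have h1 := h01 (y + p.2 + h * p.1)
      exact abs_le.2 ⟨(by norm_num : (-1 : ℝ) ≤ 0).trans h1.1, h1.2⟩
  rw [← intervalIntegral_integral_swap hint]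
  refine intervalIntegral.integral_congr fun t _ => ?_
  simp only [add_right_comm]

lemma continuous_integral_translate {F : ℝ → ℝ} (hF : Continuous F)
    (h01 : ∀ y, F y ∈ Set.Icc (0 : ℝ) 1) (μ : Measure ℝ) [IsProbabilityMeasure μ] :
    Continuous fun v => ∫ z, F (v + z) ∂μ := by
  refine continuous_of_dominated (bound := fun _ => 1) (fun v => ?_) (fun v => ?_)
    (integrable_const _) (ae_of_all _ fun z => by fun_prop)
  · exact (by fun_prop : Continuous fun z => F (v + z)).aestronglyMeasurable
  · refine ae_of_all _ fun z => abs_le.2 ⟨?_, (h01 _).2⟩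
    linarith [(h01 (v + z)).1]

/-! ### Taylor expansion of a threefold average -/

/-- Integration from `0` on either side; the negative side follows by reflection. Repeated use
produces the Taylor remainders. -/
lemma abs_le_pow_of_abs_deriv_le_pow {f f' : ℝ → ℝ} {c : ℝ} {k : ℕ}
    (hf : ∀ y, HasDerivAt f (f' y) y) (h0 : f 0 = 0) (hb : ∀ y, |f' y| ≤ c * |y| ^ k) (y : ℝ) :
    |f y| ≤ c * (|y| ^ (k + 1) / (k + 1)) := by
  have main : ∀ {f f' : ℝ → ℝ}, (∀ y, HasDerivAt f (f' y) y) → f 0 = 0 →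
      (∀ y, |f' y| ≤ c * |y| ^ k) → ∀ y, 0 ≤ y → |f y| ≤ c * (y ^ (k + 1) / (k + 1)) := by
    intro f f' hf h0 hb y hy
    have hB : ∀ x : ℝ, HasDerivAt (fun x : ℝ => c * (x ^ (k + 1) / (k + 1))) (c * x ^ k) x := by
      intro x
      have := ((hasDerivAt_pow (k + 1) x).div_const ((k : ℝ) + 1)).const_mul c
      refine this.congr_deriv ?_
      have : (k : ℝ) + 1 ≠ 0 := by positivity
      push_cast
      field_simp
    refine image_norm_le_of_norm_deriv_right_le_deriv_boundary (f := f) (f' := f') (a := 0) (b := y)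
      (fun x _ => (hf x).continuousAt.continuousWithinAt) (fun x _ => (hf x).hasDerivWithinAt)
      (by simp [h0]) hB (fun x hx => ?_) ⟨hy, le_rfl⟩
    simpa [abs_of_nonneg hx.1] using hb x
  rcases le_total 0 y with hy | hy
  · simpa [abs_of_nonneg hy] using main hf h0 hb y hy
  · have h1 : ∀ x, HasDerivAt (fun x => f (-x)) (-f' (-x)) x := fun x =>
      ((hf (-x)).comp x (hasDerivAt_neg x)).congr_deriv (by simp)
    have := main h1 (by simpa using h0) (fun x => by simpa using hb (-x)) (-y) (by linarith)
    simpa [abs_of_nonpos hy] using this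

/-- The slope at `0` of the threefold average of `F`. -/
noncomputable def averageSlope (h : ℝ) (F : ℝ → ℝ) : ℝ :=
  (slidingAverage h (slidingAverage h F) (h / 2) -
    slidingAverage h (slidingAverage h F) (-(h / 2))) / h

/-- The second derivative at `0` of the threefold average of `F`. -/
noncomputable def averageCurvature (h : ℝ) (F : ℝ → ℝ) : ℝ :=
  (slidingAverage h F h - 2 * slidingAverage h F 0 + slidingAverage h F (-h)) / h ^ 2

/-- The threefold average of `F`. -/
noncomputable def tripleAverage (h : ℝ) (F : ℝ → ℝ) : ℝ → ℝ :=
  slidingAverage h (slidingAverage h (slidingAverage h F))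

/-- The third derivative is a third difference of `F` over `h ^ 3`. Integrating its bound gives the
cubic estimate; bounding the variation of the second derivative directly gives the quadratic one,
needed for large `y`, where third moments may be infinite. -/
lemma tripleAverage_taylor {h : ℝ} (hh : 0 < h) {F : ℝ → ℝ} (hF : Continuous F)
    (h01 : ∀ y, F y ∈ Set.Icc (0 : ℝ) 1) (y : ℝ) :
    |tripleAverage h F y - tripleAverage h F 0 - averageSlope h F * y
        - averageCurvature h F * (y ^ 2 / 2)| ≤ 2 / 3 * min (|y / h| ^ 3) (3 * |y / h| ^ 2) := by
  set A1 := slidingAverage h F with hA1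
  set A2 := slidingAverage h A1 with hA2
  have c1 : Continuous A1 := continuous_slidingAverage_apply h hF
  have c2 : Continuous A2 := continuous_slidingAverage_apply h c1
  have d1 := fun y => hasDerivAt_slidingAverage hh.ne' hF y
  have d2 := fun y => hasDerivAt_slidingAverage hh.ne' c1 y
  have d3 := fun y => hasDerivAt_slidingAverage hh.ne' c2 y
  rw [← hA1] at d1
  rw [← hA2] at d2
  set b := averageCurvature h F with hb
  set a := averageSlope h F with ha
  have e2 : ∀ y, HasDerivAt (fun y => (A1 (y + h) - 2 * A1 y + A1 (y - h)) / h ^ 2 - b)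
      ((F (y + 3 * h / 2) - 3 * F (y + h / 2) + 3 * F (y - h / 2) - F (y - 3 * h / 2)) / h ^ 3)
      y := by
    intro y
    have := ((((d1 (y + h)).comp_add_const y h).sub ((d1 y).const_mul 2)).add
      ((d1 (y - h)).comp_sub_const y h)).div_const (h ^ 2) |>.sub_const b
    refine this.congr_deriv ?_
    rw [show y + h + h / 2 = y + 3 * h / 2 by ring, show y + h - h / 2 = y + h / 2 by ring,
      show y - h + h / 2 = y - h / 2 by ring, show y - h - h / 2 = y - 3 * h / 2 by ring]
    field_simp
    ring
  have e1 : ∀ y, HasDerivAt (fun y => (A2 (y + h / 2) - A2 (y - h / 2)) / h - a - b * y)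
      ((A1 (y + h) - 2 * A1 y + A1 (y - h)) / h ^ 2 - b) y := by
    intro y
    have := ((((d2 (y + h / 2)).comp_add_const y (h / 2)).sub
      ((d2 (y - h / 2)).comp_sub_const y (h / 2))).div_const h |>.sub_const a).sub
      ((hasDerivAt_id y).const_mul b)
    refine this.congr_deriv ?_
    rw [show y + h / 2 + h / 2 = y + h by ring, show y + h / 2 - h / 2 = y by ring,
      show y - h / 2 + h / 2 = y by ring, show y - h / 2 - h / 2 = y - h by ring]
    field_simp
    ring
  have e0 : ∀ y, HasDerivAt (fun y => tripleAverage h F y - tripleAverage h F 0 - a * y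
      - b * (y ^ 2 / 2)) ((A2 (y + h / 2) - A2 (y - h / 2)) / h - a - b * y) y := by
    intro y
    have := (((d3 y).sub_const (tripleAverage h F 0)).sub ((hasDerivAt_id y).const_mul a)).sub
      (((hasDerivAt_pow 2 y).div_const 2).const_mul b)
    refine this.congr_deriv ?_
    simp
  have z2 : (A1 (0 + h) - 2 * A1 0 + A1 (0 - h)) / h ^ 2 - b = 0 := by
    rw [hb, averageCurvature, zero_add, zero_sub, sub_self]
  have z1 : (A2 (0 + h / 2) - A2 (0 - h / 2)) / h - a - b * 0 = 0 := by
    rw [ha, averageSlope, zero_add, zero_sub, mul_zero, sub_self, sub_self]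
  have z0 : tripleAverage h F 0 - tripleAverage h F 0 - a * 0 - b * (0 ^ 2 / 2) = 0 := by simp
  have m1 := slidingAverage_mem_Icc h hF h01
  rw [← hA1] at m1
  -- The weights `1, -3, 3, -1` have positive part 4 and negative part 4, and `F` takes values in
  -- `[0, 1]`.
  have b3 : ∀ y, |(F (y + 3 * h / 2) - 3 * F (y + h / 2) + 3 * F (y - h / 2)
      - F (y - 3 * h / 2)) / h ^ 3| ≤ 4 / h ^ 3 * |y| ^ 0 := by
    intro y
    rw [pow_zero, mul_one, abs_div, abs_of_pos (pow_pos hh 3)]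
    refine div_le_div_of_nonneg_right (abs_le.2 ⟨?_, ?_⟩) (pow_pos hh 3).le <;>
    linarith [(h01 (y + 3 * h / 2)).1, (h01 (y + h / 2)).1, (h01 (y - h / 2)).1,
      (h01 (y - 3 * h / 2)).1, (h01 (y + 3 * h / 2)).2, (h01 (y + h / 2)).2, (h01 (y - h / 2)).2,
      (h01 (y - 3 * h / 2)).2]
  -- Each second difference of a function with values in `[0, 1]` lies in `[-2, 2]`, so two of them
  -- differ by at most 4.
  have b2 : ∀ y, |(A1 (y + h) - 2 * A1 y + A1 (y - h)) / h ^ 2 - b| ≤ 4 / h ^ 2 * |y| ^ 0 := by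
    intro y
    rw [pow_zero, mul_one, hb, averageCurvature, ← hA1, ← sub_div, abs_div,
      abs_of_pos (pow_pos hh 2)]
    refine div_le_div_of_nonneg_right (abs_le.2 ⟨?_, ?_⟩) (pow_pos hh 2).le <;>
    linarith [(m1 (y + h)).1, (m1 y).1, (m1 (y - h)).1, (m1 h).1, (m1 0).1, (m1 (-h)).1,
      (m1 (y + h)).2, (m1 y).2, (m1 (y - h)).2, (m1 h).2, (m1 0).2, (m1 (-h)).2]
  have r1 := abs_le_pow_of_abs_deriv_le_pow e1 z1 b2
  have r2 := abs_le_pow_of_abs_deriv_le_pow (c := 4 / h ^ 2) (k := 1) e0 z0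
    (fun y => by simpa using r1 y) y
  have r3 := abs_le_pow_of_abs_deriv_le_pow e2 z2 b3
  have r4 := abs_le_pow_of_abs_deriv_le_pow (c := 4 / h ^ 3) (k := 1) e1 z1
    (fun y => by simpa using r3 y)
  have r5 := abs_le_pow_of_abs_deriv_le_pow (c := 2 / h ^ 3) (k := 2) e0 z0
    (fun y => (r4 y).trans_eq (by norm_num; ring)) y
  rw [mul_min_of_nonneg _ _ (by norm_num), abs_div, abs_of_pos hh]
  refine le_min (r5.trans_eq ?_) (r2.trans_eq ?_)
  · norm_num
    field_simp
  · norm_num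
    field_simp
    norm_num

/-! ### Moments of the standard normal law -/

lemma integrable_abs_pow_gaussianReal (k : ℕ) :
    Integrable (fun z : ℝ => |z| ^ k) (gaussianReal 0 1) := by
  have := (memLp_id_gaussianReal (μ := 0) (v := 1) k).integrable_norm_pow'
  simpa using this

lemma integrable_pow_gaussianReal (k : ℕ) :
    Integrable (fun z : ℝ => z ^ k) (gaussianReal 0 1) :=
  (integrable_abs_pow_gaussianReal k).mono' (by fun_prop) (ae_of_all _ fun z => by simp)

lemma integral_sq_gaussianReal : ∫ z, z ^ 2 ∂(gaussianReal 0 1) = 1 := by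
  have h := variance_fun_id_gaussianReal (μ := 0) (v := 1)
  rw [variance_eq_integral (by fun_prop), integral_id_gaussianReal] at h
  simpa using h

/-- The exact value is `4 / √(2π)`, computed from the Gamma function; `√(2π) ≥ 5/2` suffices. -/
lemma integral_abs_cube_gaussianReal_le : ∫ z, |z| ^ 3 ∂(gaussianReal 0 1) ≤ 8 / 5 := by
  rw [integral_gaussianReal_eq_integral_smul one_ne_zero]
  have h1 : ∀ z : ℝ, gaussianPDFReal 0 1 z • |z| ^ 3 =
      (√(2 * Real.pi))⁻¹ * (|z| ^ (3 : ℝ) * Real.exp (-(1 / 2) * |z| ^ (2 : ℝ))) := by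
    intro z
    rw [gaussianPDFReal]
    norm_cast
    rw [sq_abs]
    simp only [sub_zero, smul_eq_mul, mul_one]
    ring_nf
  simp_rw [h1]
  rw [integral_const_mul, integral_comp_abs
    (f := fun z : ℝ => z ^ (3 : ℝ) * Real.exp (-(1 / 2) * z ^ (2 : ℝ))),
    integral_rpow_mul_exp_neg_mul_rpow (by norm_num) (by norm_num) (by norm_num)]
  have hg : Real.Gamma ((3 + 1) / 2) = 1 := by
    rw [show ((3 : ℝ) + 1) / 2 = 2 by norm_num, Real.Gamma_two]
  have hr : (1 / 2 : ℝ) ^ (-(3 + 1) / 2 : ℝ) = 4 := by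
    rw [show (-(3 + 1) / 2 : ℝ) = ((-2 : ℤ) : ℝ) by norm_num, Real.rpow_intCast]
    norm_num
  rw [hg, hr]
  have h2 : (5 / 2 : ℝ) ≤ √(2 * Real.pi) := by
    apply Real.le_sqrt_of_sq_le
    linarith [Real.pi_gt_d2]
  have h3 : (√(2 * Real.pi))⁻¹ ≤ (5 / 2 : ℝ)⁻¹ := inv_anti₀ (by norm_num) h2
  linarith

/-! ### Brownian motion and linear barriers -/

section Barrier

variable {Ω' : Type*} [MeasurableSpace Ω'] {P : Measure Ω'}

lemma lintegral_exp_gaussianReal (c : ℝ) (v : NNReal) :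
    ∫⁻ u, ENNReal.ofReal (Real.exp (c * u)) ∂(gaussianReal 0 v) =
      ENNReal.ofReal (Real.exp (v * c ^ 2 / 2)) := by
  rw [← ofReal_integral_eq_lintegral_ofReal (integrable_exp_mul_gaussianReal c)
    (ae_of_all _ fun u => (Real.exp_pos _).le)]
  congr 1
  have := congrFun (mgf_fun_id_gaussianReal (μ := 0) (v := v)) c
  simpa [mgf] using this

/-- A pre-Brownian motion started at `y` crosses the line `x + x t` on a finite set of times with
probability at most `exp (-2 x (x - y))`. -/
theorem measure_crossing_le {M : NNReal → Ω' → ℝ} (hM : IsPreBrownianReal M P) (T : Finset NNReal)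
    {x : ℝ} (hx : 0 < x) (y : ℝ) :
    P {ω | ∃ t ∈ T, x + x * t ≤ y + M t ω} ≤ ENNReal.ofReal (Real.exp (-(2 * x * (x - y)))) := by
  classical
  have hP : IsProbabilityMeasure P := hM.isGaussianProcess.isProbabilityMeasure
  induction hN : T.card generalizing M T y with
  | zero => simp [Finset.card_eq_zero.1 hN]
  | succ N ih =>
    have hne : T.Nonempty := Finset.card_pos.1 (by omega)
    -- Conditioning on the value at the earliest time restarts the process with one time fewer; the
    -- same barrier reappears after lowering the start by `x * t₀`. This replaces optional stopping.
    set t₀ := T.min' hne with ht₀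
    set T' := (T.erase t₀).image fun t => t - t₀ with hT'
    have hmem : ∀ t ∈ T, t₀ ≤ t := fun t ht => T.min'_le t ht
    have hcard : T'.card = N := by
      rw [hT', Finset.card_image_of_injOn, Finset.card_erase_of_mem (T.min'_mem hne), hN]
      · rfl
      · intro a ha b hb hab
        have ha' := hmem a (Finset.mem_of_mem_erase ha)
        have hb' := hmem b (Finset.mem_of_mem_erase hb)
        exact (tsub_left_inj ha' hb').1 hab
    set V : Ω' → T' → ℝ := fun ω t => M (t₀ + t) ω - M t₀ ω with hV
    have hmeas := hM.aemeasurable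
    have hVm : AEMeasurable V P := aemeasurable_pi_lambda _ fun t => (hmeas _).sub (hmeas _)
    have hind : IndepFun (M t₀) V P :=
      ((hM.indepFun_shift t₀).comp (φ := fun (z : NNReal → ℝ) (t : T') => z t)
        (ψ := fun z : Set.Iic t₀ → ℝ => z ⟨t₀, Set.mem_Iic.2 le_rfl⟩)
        (by fun_prop) (by fun_prop)).symm
    set S : Set (ℝ × (T' → ℝ)) := {q | x + x * t₀ ≤ y + q.1} ∪
      ⋃ t : T', {q | x + x * (t : NNReal) ≤ (y + q.1 - x * t₀) + q.2 t} with hS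
    have hSm : MeasurableSet S := by
      refine (measurableSet_le (by fun_prop) (by fun_prop)).union (MeasurableSet.iUnion fun t => ?_)
      exact measurableSet_le (by fun_prop) (by fun_prop)
    have hsub : {ω | ∃ t ∈ T, x + x * t ≤ y + M t ω} ⊆ (fun ω => (M t₀ ω, V ω)) ⁻¹' S := by
      rintro ω ⟨t, ht, hle⟩
      by_cases h : t = t₀
      · exact Or.inl (h ▸ hle)
      · have hle' := hmem t ht
        refine Or.inr (Set.mem_iUnion.2 ⟨⟨t - t₀, Finset.mem_image_of_mem _
          (Finset.mem_erase.2 ⟨h, ht⟩)⟩, ?_⟩)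
        simp only [Set.mem_ofPred_eq, hV, add_tsub_cancel_of_le hle', NNReal.coe_sub hle']
        linarith
    have hslice : ∀ u, P.map V (Prod.mk u ⁻¹' S) ≤
        ENNReal.ofReal (Real.exp (-(2 * x * (x - (y - x * t₀)))) * Real.exp (2 * x * u)) := by
      intro u
      rw [← Real.exp_add]
      have hmap : IsProbabilityMeasure (P.map V) := Measure.isProbabilityMeasure_map hVm
      -- If the barrier is already reached at `t₀`, the exponential bound is at least 1.
      by_cases hu : x + x * t₀ ≤ y + u
      · refine prob_le_one.trans ?_
        rw [← ENNReal.ofReal_one]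
        refine ENNReal.ofReal_le_ofReal (Real.one_le_exp ?_)
        nlinarith
      · rw [Measure.map_apply_of_aemeasurable hVm (measurable_prodMk_left hSm)]
        refine (measure_mono ?_).trans ((ih (hM.shift t₀) T' (y + u - x * t₀) hcard).trans_eq ?_)
        · rintro ω (h | h)
          · exact absurd h hu
          · obtain ⟨t, ht⟩ := Set.mem_iUnion.1 h
            exact ⟨t, t.2, ht⟩
        · congr 2
          ring
    calc P {ω | ∃ t ∈ T, x + x * t ≤ y + M t ω}
        ≤ P ((fun ω => (M t₀ ω, V ω)) ⁻¹' S) := measure_mono hsub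
      _ = ∫⁻ u, P.map V (Prod.mk u ⁻¹' S) ∂(P.map (M t₀)) := by
          rw [← Measure.map_apply_of_aemeasurable ((hmeas _).prodMk hVm) hSm,
            (indepFun_iff_map_prod_eq_prod_map_map (hmeas _) hVm).1 hind, Measure.prod_apply hSm]
      _ ≤ ∫⁻ u, ENNReal.ofReal (Real.exp (-(2 * x * (x - (y - x * t₀)))) * Real.exp (2 * x * u))
            ∂(gaussianReal 0 t₀) := by
          rw [(hM.hasLaw_eval t₀).map_eq]
          exact lintegral_mono hslice
      -- The Gaussian average of `exp (2xu)` is `exp (2x² t₀)`, which exactly cancels the drift of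
      -- the barrier: `exp (2x (M t - x t))` is a martingale.
      _ = ENNReal.ofReal (Real.exp (-(2 * x * (x - y)))) := by
          simp_rw [ENNReal.ofReal_mul (Real.exp_pos _).le]
          rw [lintegral_const_mul' _ _ ENNReal.ofReal_ne_top, lintegral_exp_gaussianReal,
            ← ENNReal.ofReal_mul (Real.exp_pos _).le, ← Real.exp_add]
          congr 2
          ring

/-- The Brownian bridge `W t - t W 1`, `0 ≤ t ≤ 1`, time-changed to a Brownian motion. -/
lemma isBrownianReal_bridge {W : NNReal → Ω' → ℝ} (hW : IsBrownianReal W P) :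
    IsBrownianReal (fun s ω => (1 + s) * W (s / (1 + s)) ω - s * W 1 ω) P where
  toIsPreBrownianReal := by
    have hG := hW.isGaussianProcess
    have hL2 : ∀ t, MemLp (W t) 2 P := fun t => (hG.hasGaussianLaw_eval t).memLp_two
    have hP : IsProbabilityMeasure P := hG.isProbabilityMeasure
    refine IsGaussianProcess.isPreBrownianReal_of_covariance ?_ (fun t => ?_) (fun s t hst => ?_)
    · refine hG.of_isGaussianProcess fun s => ?_
      exact ⟨{s / (1 + s), 1},
        { toFun z := (1 + s) * z ⟨s / (1 + s), by simp⟩ - s * z ⟨1, by simp⟩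
          map_add' a b := by simp; ring
          map_smul' c a := by simp; ring }, by simp⟩
    · rw [integral_sub ((hW.integrable_eval _).const_mul _) ((hW.integrable_eval _).const_mul _),
        integral_const_mul, integral_const_mul, hW.integral_eval, hW.integral_eval]
      simp
    · have h1 : ∀ u : NNReal, u / (1 + u) ≤ 1 := fun u =>
        div_le_one_of_le₀ (le_add_of_nonneg_left zero_le_one) zero_le
      have h2 : s / (1 + s) ≤ t / (1 + t) := by
        rw [div_le_div_iff₀ (by positivity) (by positivity), mul_add, mul_add, mul_one, mul_one,
          mul_comm t s]
        gcongr
      have hL2' : ∀ (c : ℝ) t, MemLp (fun ω => c * W t ω) 2 P := fun c t => (hL2 t).const_mul c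
      rw [covariance_fun_sub_fun_sub (hL2' _ _) (hL2' _ _) (hL2' _ _) (hL2' _ _)]
      simp only [covariance_const_mul_left, covariance_const_mul_right, hW.covariance_fun_eval]
      rw [min_eq_left h2, min_eq_left (h1 s), min_eq_right (h1 t), min_self]
      push_cast
      field_simp
      ring
  cont := by
    filter_upwards [hW.cont] with ω h
    refine Continuous.sub (Continuous.mul (by fun_prop) (h.comp ?_)) (by fun_prop)
    exact Continuous.div (by fun_prop) (by fun_prop) fun s => by positivity

/-- A Brownian motion ever exceeds the line `x + x t` with probability at most `exp (-2 x²)`. -/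
theorem measure_crossing_real_le {M : NNReal → Ω' → ℝ} (hM : IsBrownianReal M P)
    {x : ℝ} (hx : 0 < x) :
    P {ω | ∃ t : NNReal, x + x * t < M t ω} ≤ ENNReal.ofReal (Real.exp (-(2 * x ^ 2))) := by
  classical
  set q := TopologicalSpace.denseSeq NNReal with hq
  have hdense : DenseRange q := TopologicalSpace.denseRange_denseSeq NNReal
  -- Strict crossing is an open condition on the time, so by path continuity it is seen by a dense
  -- sequence; finite parts of that sequence increase to it.
  set A : ℕ → Set Ω' := fun N => {ω | ∃ t ∈ (Finset.range N).image q, x + x * t ≤ 0 + M t ω} with hA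
  have hmono : Monotone A := by
    rintro N N' h ω ⟨t, ht, hle⟩
    exact ⟨t, Finset.image_subset_image (Finset.range_mono h) ht, hle⟩
  have hae : {ω | ∃ t : NNReal, x + x * t < M t ω} ≤ᵐ[P] ⋃ N, A N := by
    filter_upwards [hM.cont] with ω hc
    rintro ⟨t, ht⟩
    have hopen : IsOpen {t : NNReal | x + x * t < M t ω} :=
      isOpen_lt (by fun_prop) hc
    obtain ⟨i, hi⟩ := hdense.exists_mem_open hopen ⟨t, ht⟩
    refine Set.mem_iUnion.2 ⟨i + 1, q i, Finset.mem_image_of_mem _ (by simp), ?_⟩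
    rw [zero_add]
    exact le_of_lt hi
  refine (measure_mono_ae hae).trans ?_
  rw [hmono.measure_iUnion]
  refine iSup_le fun N => (measure_crossing_le hM.toIsPreBrownianReal _ hx 0).trans_eq ?_
  congr 2
  ring

/-- A tail bound for the maximum of the modulus of the Brownian bridge. -/
theorem measure_bridge_le {W : NNReal → Ω' → ℝ} (hW : IsBrownianReal W P) {x : ℝ} (hx : 0 < x) :
    P {ω | ∃ t : NNReal, t < 1 ∧ x < |W t ω - t * W 1 ω|} ≤
      ENNReal.ofReal (2 * Real.exp (-(2 * x ^ 2))) := by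
  -- With `s = t / (1 - t)`, dividing by `1 - t` turns the constant level `x` for the bridge into
  -- the line `x + x s` for the time-changed motion. The two signs give the factor 2.
  have hsub : {ω | ∃ t : NNReal, t < 1 ∧ x < |W t ω - t * W 1 ω|} ⊆
      {ω | ∃ s : NNReal, x + x * s < (1 + s) * W (s / (1 + s)) ω - s * W 1 ω} ∪
      {ω | ∃ s : NNReal, x + x * s < (1 + s) * (-W) (s / (1 + s)) ω - s * (-W) 1 ω} := by
    rintro ω ⟨t, ht, hlt⟩
    have ht' : (0 : ℝ) < 1 - t := by
      have : (t : ℝ) < 1 := by exact_mod_cast ht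
      linarith
    have h1 : 1 + t / (1 - t) = 1 / (1 - t) := by
      have : (1 - t) ≠ 0 := (tsub_pos_of_lt ht).ne'
      field_simp
      exact tsub_add_cancel_of_le ht.le
    have h2 : t / (1 - t) / (1 + t / (1 - t)) = t := by
      have : (1 - t) ≠ 0 := (tsub_pos_of_lt ht).ne'
      rw [h1]
      field_simp
    have h3 : ((t / (1 - t) : NNReal) : ℝ) = t / (1 - t) := by
      rw [NNReal.coe_div, NNReal.coe_sub ht.le, NNReal.coe_one]
    rcases lt_abs.1 hlt with h | h
    · left
      refine ⟨t / (1 - t), ?_⟩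
      rw [h2, h3]
      have := div_lt_div_of_pos_right h ht'
      calc x + x * (t / (1 - t)) = x / (1 - t) := by field_simp; ring
        _ < _ := this
        _ = _ := by field_simp; ring
    · right
      refine ⟨t / (1 - t), ?_⟩
      rw [h2, h3]
      have := div_lt_div_of_pos_right h ht'
      simp only [Pi.neg_apply]
      calc x + x * (t / (1 - t)) = x / (1 - t) := by field_simp; ring
        _ < _ := this
        _ = _ := by field_simp; ring
  refine (measure_mono hsub).trans ((measure_union_le _ _).trans ?_)
  rw [two_mul, ENNReal.ofReal_add (Real.exp_pos _).le (Real.exp_pos _).le]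
  exact add_le_add (measure_crossing_real_le (isBrownianReal_bridge hW) hx)
    (measure_crossing_real_le (isBrownianReal_bridge hW.neg) hx)

end Barrier

/-! ### Tubes around a set of polygonal paths -/

/-- Paths which agree with some path of `S` before time `k` and stay `κ`-close to it afterwards. -/
def pathTube {n : ℕ} (S : Set (Fin (n + 1) → ℝ)) (κ : ℝ) (k : ℕ) : Set (Fin (n + 1) → ℝ) :=
  {w | ∃ s ∈ S, (∀ j : Fin (n + 1), (j : ℕ) < k → w j = s j) ∧
    ∀ j : Fin (n + 1), k ≤ (j : ℕ) → |w j - s j| ≤ κ}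

/-- A continuous version of the indicator of the tube. -/
noncomputable def tubeIndicator {n : ℕ} (S : Set (Fin (n + 1) → ℝ)) (κ : ℝ) {η : ℝ} (hη : 0 < η)
    (k : ℕ) (w : Fin (n + 1) → ℝ) : ℝ :=
  thickenedIndicator hη (pathTube S κ k) w

section Tube

variable {n : ℕ} (S : Set (Fin (n + 1) → ℝ)) {κ η : ℝ} (hη : 0 < η) (k : ℕ)

lemma continuous_tubeIndicator : Continuous (tubeIndicator S κ hη k) :=
  NNReal.continuous_coe.comp (thickenedIndicator hη (pathTube S κ k)).continuous

lemma tubeIndicator_mem_Icc (w : Fin (n + 1) → ℝ) : tubeIndicator S κ hη k w ∈ Set.Icc (0 : ℝ) 1 :=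
  ⟨NNReal.coe_nonneg _, by exact_mod_cast thickenedIndicator_le_one hη _ w⟩

variable {S k}

lemma tubeIndicator_eq_one {w : Fin (n + 1) → ℝ} (hw : w ∈ pathTube S κ k) :
    tubeIndicator S κ hη k w = 1 := by
  rw [tubeIndicator, thickenedIndicator_one hη _ hw, NNReal.coe_one]

lemma tubeIndicator_eq_zero {w : Fin (n + 1) → ℝ}
    (hw : w ∉ Metric.thickening η (pathTube S κ k)) : tubeIndicator S κ hη k w = 0 := by
  rw [tubeIndicator, thickenedIndicator_zero hη _ hw, NNReal.coe_zero]

/-- Translating by `w' - w` maps the tube at `k + 1` into the tube at `k`: only coordinate `k`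
moves, and there exact agreement is relaxed to `κ`-closeness. Translations preserve distance, so the
thickened indicators compare. -/
lemma tubeIndicator_succ_le {w w' : Fin (n + 1) → ℝ}
    (hne : ∀ j : Fin (n + 1), (j : ℕ) ≠ k → w' j = w j)
    (hk : ∀ j : Fin (n + 1), (j : ℕ) = k → |w' j - w j| ≤ κ) :
    tubeIndicator S κ hη (k + 1) w ≤ tubeIndicator S κ hη k w' := by
  have hinf : Metric.infEDist w' (pathTube S κ k) ≤ Metric.infEDist w (pathTube S κ (k + 1)) := by
    refine le_iInf₂ fun a ha => ?_
    obtain ⟨s, hs, h1, h2⟩ := ha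
    have hmem : a + (w' - w) ∈ pathTube S κ k := by
      refine ⟨s, hs, fun j hj => ?_, fun j hj => ?_⟩
      · simp [h1 j (by omega), hne j (by omega)]
      · rcases hj.eq_or_lt with h | h
        · have := hk j h.symm
          simpa [h1 j (by omega), abs_sub_comm] using this
        · have := h2 j (by omega)
          simpa [hne j (by omega)] using this
    calc Metric.infEDist w' (pathTube S κ k) ≤ edist w' (a + (w' - w)) :=
          Metric.infEDist_le_edist_of_mem hmem
      _ = edist (w + (w' - w)) (a + (w' - w)) := by rw [add_sub_cancel]
      _ = edist w a := edist_add_right _ _ _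
  simp only [tubeIndicator, thickenedIndicator_apply, NNReal.coe_le_coe]
  refine ENNReal.toNNReal_mono (thickenedIndicatorAux_lt_top).ne ?_
  exact tsub_le_tsub_left (ENNReal.div_le_div_right hinf _) _

end Tube

/-! ### Conditional probabilities of hitting the tube -/

section Potential

variable {Ω' : Type*} [MeasurableSpace Ω']

/-- The path equal to `s` before time `k` and to `v + W j - W k` afterwards. -/
noncomputable def hybridPath (n k : ℕ) (W : NNReal → Ω' → ℝ) (s : ℕ → ℝ) (v : ℝ) (ω : Ω') :
    Fin (n + 1) → ℝ :=
  fun j => if (j : ℕ) < k then s j else v + (W j ω - W k ω)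

variable {n : ℕ} (S : Set (Fin (n + 1) → ℝ)) (κ : ℝ) {η : ℝ} (hη : 0 < η)
  (W : NNReal → Ω' → ℝ) (P : Measure Ω')

/-- The expected tube indicator of a hybrid path. -/
noncomputable def tubeValue (k : ℕ) (s : ℕ → ℝ) (v : ℝ) : ℝ :=
  ∫ ω, tubeIndicator S κ hη k (hybridPath n k W s v ω) ∂P

/-- The tube value, smoothed with respect to the position at time `k`. -/
noncomputable def tubePotential (h : ℝ) (k : ℕ) (s : ℕ → ℝ) : ℝ :=
  tripleAverage h (tubeValue S κ hη W P k s) (s k)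

lemma continuous_hybridPath {α : Type*} {n : ℕ} (W : NNReal → α → ℝ) (k : ℕ) (ω : α) :
    Continuous fun p : (ℕ → ℝ) × ℝ => hybridPath n k W p.1 p.2 ω := by
  refine continuous_pi fun j => ?_
  unfold hybridPath
  split_ifs <;> fun_prop

variable {W P}

lemma aemeasurable_hybridPath (hW : IsPreBrownianReal W P) (k : ℕ) (s : ℕ → ℝ) (v : ℝ) :
    AEMeasurable (hybridPath n k W s v) P := by
  refine aemeasurable_pi_lambda _ fun j => ?_
  have h := hW.aemeasurable
  unfold hybridPath
  split_ifs
  · exact aemeasurable_const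
  · exact ((h _).sub (h _)).const_add v

lemma aestronglyMeasurable_tubeIndicator_comp {w : Ω' → Fin (n + 1) → ℝ} (hw : AEMeasurable w P)
    (k : ℕ) : AEStronglyMeasurable (fun ω => tubeIndicator S κ hη k (w ω)) P :=
  ((continuous_tubeIndicator S hη k).measurable.comp_aemeasurable hw).aestronglyMeasurable

lemma integrable_tubeIndicator_comp [IsFiniteMeasure P] {w : Ω' → Fin (n + 1) → ℝ}
    (hw : AEMeasurable w P) (k : ℕ) : Integrable (fun ω => tubeIndicator S κ hη k (w ω)) P := by
  refine Integrable.of_bound (C := 1) (aestronglyMeasurable_tubeIndicator_comp S κ hη hw k)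
    (ae_of_all _ fun ω => ?_)
  have := tubeIndicator_mem_Icc S (κ := κ) hη k (w ω)
  rw [Real.norm_of_nonneg this.1]
  exact this.2

lemma continuous_tubeValue (hW : IsPreBrownianReal W P) (k : ℕ) :
    Continuous (Function.uncurry (tubeValue S κ hη W P k)) := by
  have hP : IsProbabilityMeasure P := hW.isGaussianProcess.isProbabilityMeasure
  refine continuous_of_dominated (bound := fun _ => 1) (fun p => ?_) (fun p => ?_)
    (integrable_const _) (ae_of_all _ fun ω => ?_)
  · exact aestronglyMeasurable_tubeIndicator_comp S κ hη (aemeasurable_hybridPath hW k p.1 p.2) k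
  · refine ae_of_all _ fun ω => ?_
    have := tubeIndicator_mem_Icc S (κ := κ) hη k (hybridPath n k W p.1 p.2 ω)
    rw [Real.norm_of_nonneg this.1]
    exact this.2
  · exact (continuous_tubeIndicator S hη k).comp (continuous_hybridPath W k ω)

lemma tubeValue_mem_Icc [IsProbabilityMeasure P] (k : ℕ) (s : ℕ → ℝ) (v : ℝ) :
    tubeValue S κ hη W P k s v ∈ Set.Icc (0 : ℝ) 1 := by
  refine ⟨integral_nonneg fun ω => (tubeIndicator_mem_Icc S hη k _).1, ?_⟩
  have : tubeValue S κ hη W P k s v ≤ ∫ _, (1 : ℝ) ∂P :=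
    integral_mono_of_nonneg (ae_of_all _ fun ω => (tubeIndicator_mem_Icc S hη k _).1)
      (integrable_const _) (ae_of_all _ fun ω => (tubeIndicator_mem_Icc S hη k _).2)
  simpa using this

/-- The position at time `k` enters only through `v`, so it can be smoothed while the past stays
fixed. -/
lemma tubeValue_congr {k : ℕ} {s s' : ℕ → ℝ} (h : ∀ j < k, s j = s' j) (v : ℝ) :
    tubeValue S κ hη W P k s v = tubeValue S κ hη W P k s' v := by
  have : ∀ ω, hybridPath n k W s v ω = hybridPath n k W s' v ω := fun ω => by
    funext j
    unfold hybridPath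
    split_ifs with hj
    · exact h _ hj
    · rfl
  simp only [tubeValue, this]

/-- Replacing a step of the discrete path by a Brownian increment. -/
lemma integral_tubeValue_succ_le (hW : IsPreBrownianReal W P) (k : ℕ) (s : ℕ → ℝ) {u : ℝ}
    (hu : |u - s k| ≤ κ) :
    ∫ z, tubeValue S κ hη W P (k + 1) s (u + z) ∂(gaussianReal 0 1) ≤
      tubeValue S κ hη W P k s u := by
  have hP : IsProbabilityMeasure P := hW.isGaussianProcess.isProbabilityMeasure
  have hm := hW.aemeasurable
  have hUm : AEMeasurable (fun ω => W (k + 1) ω - W k ω) P := (hm _).sub (hm _)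
  -- Increments after time `k + 1`. For `j ≤ k` the truncated subtraction gives the increment zero,
  -- which is never used since those coordinates come from `s`.
  set V : Ω' → Fin (n + 1) → ℝ := fun ω j =>
    W (k + 1 + ((j : ℕ) - (k + 1) : ℕ)) ω - W (k + 1) ω with hV
  have hVm : AEMeasurable V P := aemeasurable_pi_lambda _ fun j => (hm _).sub (hm _)
  have hind : IndepFun (fun ω => W (k + 1) ω - W k ω) V P :=
    ((hW.indepFun_shift (k + 1)).comp
      (φ := fun (z : NNReal → ℝ) (j : Fin (n + 1)) => z ((j : ℕ) - (k + 1) : ℕ))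
      (ψ := fun z : Set.Iic ((k : NNReal) + 1) → ℝ =>
        z ⟨k + 1, Set.mem_Iic.2 le_rfl⟩ - z ⟨k, Set.mem_Iic.2 (by simp)⟩)
      (by fun_prop) (by fun_prop)).symm
  have hlaw : P.map (fun ω => W (k + 1) ω - W k ω) = gaussianReal 0 1 := by
    have := (hW.hasLaw_sub (k + 1) k).map_eq
    have hd : nndist ((k + 1 : NNReal) : ℝ) ((k : NNReal) : ℝ) = 1 := by
      rw [← NNReal.coe_inj, coe_nndist, Real.dist_eq]
      simp
    rwa [show nndist (k + 1 : NNReal).1 (k : NNReal).1 = 1 from hd] at this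
  set w : ℝ → (Fin (n + 1) → ℝ) → Fin (n + 1) → ℝ := fun z x j =>
    if (j : ℕ) < k + 1 then s j else u + z + x j with hw
  have hwc : Continuous (Function.uncurry w) := by
    refine continuous_pi fun j => ?_
    simp only [hw, Function.uncurry]
    split_ifs <;> fun_prop
  have hpath : ∀ z ω, hybridPath n (k + 1) W s (u + z) ω = w z (V ω) := by
    intro z ω
    funext j
    simp only [hybridPath, hw, hV]
    split_ifs with hj
    · rfl
    · have : ((k : NNReal) + 1 + ((j : ℕ) - (k + 1) : ℕ)) = (j : ℕ) := by
        rw [← Nat.cast_succ, ← Nat.cast_add]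
        congr 1
        omega
      rw [this]
      push_cast
      rfl
  have hφ : Continuous (fun q : ℝ × (Fin (n + 1) → ℝ) =>
      tubeIndicator S κ hη (k + 1) (w q.1 q.2)) := (continuous_tubeIndicator S hη (k + 1)).comp hwc
  have hVp : IsProbabilityMeasure (P.map V) := Measure.isProbabilityMeasure_map hVm
  have hint : Integrable (fun q : ℝ × (Fin (n + 1) → ℝ) =>
      tubeIndicator S κ hη (k + 1) (w q.1 q.2)) ((gaussianReal 0 1).prod (P.map V)) :=
    Integrable.of_bound (C := 1) hφ.aestronglyMeasurable (ae_of_all _ fun q => by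
      have := tubeIndicator_mem_Icc S (κ := κ) hη (k + 1) (w q.1 q.2)
      rw [Real.norm_of_nonneg this.1]
      exact this.2)
  have hpair : AEMeasurable (fun ω => (W (k + 1) ω - W k ω, V ω)) P := hUm.prodMk hVm
  calc ∫ z, tubeValue S κ hη W P (k + 1) s (u + z) ∂(gaussianReal 0 1)
      = ∫ z, ∫ x, tubeIndicator S κ hη (k + 1) (w z x) ∂(P.map V) ∂(gaussianReal 0 1) := by
        refine integral_congr_ae (ae_of_all _ fun z => ?_)
        simp only [tubeValue, hpath]
        rw [integral_map hVm]
        exact (hφ.comp (f := fun x => (z, x)) (by fun_prop)).aestronglyMeasurable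
    _ = ∫ q, tubeIndicator S κ hη (k + 1) (w q.1 q.2) ∂((gaussianReal 0 1).prod (P.map V)) :=
        (integral_prod _ hint).symm
    _ = ∫ ω, tubeIndicator S κ hη (k + 1) (w (W (k + 1) ω - W k ω) (V ω)) ∂P := by
        rw [← hlaw, ← (indepFun_iff_map_prod_eq_prod_map_map hUm hVm).1 hind,
          integral_map hpair hφ.aestronglyMeasurable]
    _ ≤ tubeValue S κ hη W P k s u := by
        refine integral_mono (integrable_tubeIndicator_comp S κ hη ?_ _)
          (integrable_tubeIndicator_comp S κ hη (aemeasurable_hybridPath hW k s u) k) fun ω => ?_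
        · exact hwc.measurable.comp_aemeasurable hpair
        -- The two paths differ only at coordinate `k`, where one is `s k` and the other `u`.
        · refine tubeIndicator_succ_le hη (fun j hj => ?_) (fun j hj => ?_)
          · rw [← hpath]
            simp only [hybridPath]
            rcases lt_or_gt_of_ne hj with h | h
            · rw [if_pos h, if_pos (by omega)]
            · rw [if_neg (by omega), if_neg (by omega)]
              push_cast
              ring
          · rw [← hpath]
            simp only [hybridPath]
            rw [if_neg (by omega), if_pos (by omega), hj, sub_self, add_zero]
            exact hu

/-! ### Smoothed potentials and the one-step inequality -/

lemma slidingAverage_comp_const_add (h c : ℝ) (F : ℝ → ℝ) :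
    slidingAverage h (fun y => F (c + y)) = fun y => slidingAverage h F (c + y) := by
  funext y
  simp only [slidingAverage, add_assoc]

lemma tripleAverage_comp_const_add (h c : ℝ) (F : ℝ → ℝ) :
    tripleAverage h (fun y => F (c + y)) = fun y => tripleAverage h F (c + y) := by
  simp only [tripleAverage, slidingAverage_comp_const_add]

/-- Three windows of half-width `h / 2` reach `3h/2`, which is where the condition on `κ`
originates. -/
lemma tripleAverage_le {h κ c : ℝ} (hh : 0 ≤ h) (hκ : 3 * h / 2 ≤ κ) {F F' : ℝ → ℝ}
    (hF : Continuous F) (hF' : Continuous F') (hle : ∀ y, |y - c| ≤ κ → F y ≤ F' y) :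
    tripleAverage h F c ≤ tripleAverage h F' c := by
  have c1 := continuous_slidingAverage_apply h hF
  have c1' := continuous_slidingAverage_apply h hF'
  refine slidingAverage_le (r := 0) (c := c) hh (continuous_slidingAverage_apply h c1)
    (continuous_slidingAverage_apply h c1') (fun y hy => ?_) (by simp)
  refine slidingAverage_le hh c1 c1' (fun y hy => ?_) hy
  refine slidingAverage_le hh hF hF' (fun y hy => hle y (hy.trans ?_)) hy
  linarith

lemma tripleAverage_mem_Icc (h : ℝ) {F : ℝ → ℝ} (hF : Continuous F)
    (h01 : ∀ y, F y ∈ Set.Icc (0 : ℝ) 1) (y : ℝ) : tripleAverage h F y ∈ Set.Icc (0 : ℝ) 1 := by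
  have c1 := continuous_slidingAverage_apply h hF
  exact slidingAverage_mem_Icc h (continuous_slidingAverage_apply h c1)
    (slidingAverage_mem_Icc h c1 (slidingAverage_mem_Icc h hF h01)) y

/-- Smoothing commutes with convolution by Fubini, so the Gaussian step can be taken inside the
averages, where the tube comparison applies. -/
lemma integral_tripleAverage {h : ℝ} {F : ℝ → ℝ} (hF : Continuous F)
    (h01 : ∀ y, F y ∈ Set.Icc (0 : ℝ) 1) (μ : Measure ℝ) [IsProbabilityMeasure μ] :
    ∫ z, tripleAverage h F z ∂μ = tripleAverage h (fun v => ∫ z, F (v + z) ∂μ) 0 := by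
  have c1 := continuous_slidingAverage_apply h hF
  have c2 := continuous_slidingAverage_apply h c1
  have m1 := slidingAverage_mem_Icc h hF h01
  have m2 := slidingAverage_mem_Icc h c1 m1
  have e := integral_slidingAverage (h := h) c2 m2 μ 0
  simp only [zero_add] at e
  rw [tripleAverage, e, tripleAverage]
  congr 1
  funext v
  rw [integral_slidingAverage c1 m1 μ v]
  congr 1
  funext v
  rw [integral_slidingAverage hF h01 μ v]

/-- A Gaussian average bounds the second-order part of a smooth average. -/
lemma tripleAverage_add_curvature_le {h : ℝ} (hh : 0 < h) {F : ℝ → ℝ} (hF : Continuous F)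
    (h01 : ∀ y, F y ∈ Set.Icc (0 : ℝ) 1) :
    tripleAverage h F 0 + averageCurvature h F / 2 ≤
      ∫ z, tripleAverage h F z ∂(gaussianReal 0 1) + 16 / 15 / h ^ 3 := by
  have i1 : Integrable (fun z : ℝ => z) (gaussianReal 0 1) := by
    simpa using integrable_pow_gaussianReal 1
  have i2 := integrable_pow_gaussianReal 2
  have i3 := integrable_abs_pow_gaussianReal 3
  set a := averageSlope h F
  set b := averageCurvature h F
  set g := tripleAverage h F 0
  -- Integrating this minorant against the normal law kills the linear term and leaves `b / 2`; the
  -- cubic term costs at most `2/3 · 8/5 = 16/15` over `h ^ 3`.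
  have hpt : ∀ z, g + a * z + b / 2 * z ^ 2 - 2 / 3 / h ^ 3 * |z| ^ 3 ≤ tripleAverage h F z := by
    intro z
    have := (abs_le.1 (tripleAverage_taylor hh hF h01 z)).1
    have h2 : 2 / 3 * min (|z / h| ^ 3) (3 * |z / h| ^ 2) ≤ 2 / 3 / h ^ 3 * |z| ^ 3 := by
      calc 2 / 3 * min (|z / h| ^ 3) (3 * |z / h| ^ 2) ≤ 2 / 3 * |z / h| ^ 3 := by
            gcongr
            exact min_le_left _ _
        _ = 2 / 3 / h ^ 3 * |z| ^ 3 := by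
            rw [abs_div, abs_of_pos hh]
            field_simp
    change -_ ≤ tripleAverage h F z - g - a * z - b * (z ^ 2 / 2) at this
    linarith
  have hc3 : Continuous (tripleAverage h F) := continuous_slidingAverage_apply h
    (continuous_slidingAverage_apply h (continuous_slidingAverage_apply h hF))
  have hGi : Integrable (tripleAverage h F) (gaussianReal 0 1) :=
    Integrable.of_bound (C := 1) hc3.aestronglyMeasurable (ae_of_all _ fun z => by
      have := tripleAverage_mem_Icc h hF h01 z
      rw [Real.norm_of_nonneg this.1]
      exact this.2)
  have j1 : Integrable (fun z : ℝ => g + a * z) (gaussianReal 0 1) :=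
    (integrable_const g).add (i1.const_mul a)
  have j2 : Integrable (fun z : ℝ => g + a * z + b / 2 * z ^ 2) (gaussianReal 0 1) :=
    j1.add (i2.const_mul _)
  have := integral_mono (j2.sub (i3.const_mul (2 / 3 / h ^ 3))) hGi hpt
  have e : ∫ z, (g + a * z + b / 2 * z ^ 2 - 2 / 3 / h ^ 3 * |z| ^ 3) ∂(gaussianReal 0 1) =
      g + b / 2 - 2 / 3 / h ^ 3 * ∫ z, |z| ^ 3 ∂(gaussianReal 0 1) := by
    rw [integral_sub j2 (i3.const_mul _), integral_add j1 (i2.const_mul _),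
      integral_add (integrable_const g) (i1.const_mul a), integral_const_mul, integral_const_mul,
      integral_const_mul, integral_sq_gaussianReal, integral_id_gaussianReal]
    simp
  change ∫ z, (g + a * z + b / 2 * z ^ 2 - 2 / 3 / h ^ 3 * |z| ^ 3) ∂(gaussianReal 0 1) ≤ _ at this
  rw [e] at this
  have h3 : 2 / 3 / h ^ 3 * ∫ z, |z| ^ 3 ∂(gaussianReal 0 1) ≤ 2 / 3 / h ^ 3 * (8 / 5) :=
    mul_le_mul_of_nonneg_left integral_abs_cube_gaussianReal_le (by positivity)
  have h4 : 2 / 3 / h ^ 3 * (8 / 5) = 16 / 15 / h ^ 3 := by ring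
  linarith

/-- The slope at time `k` of the potential in the next step. -/
noncomputable def potentialSlope (W : NNReal → Ω' → ℝ) (P : Measure Ω') (h : ℝ) (k : ℕ)
    (s : ℕ → ℝ) : ℝ :=
  averageSlope h fun y => tubeValue S κ hη W P (k + 1) s (s k + y)

/-- The curvature at time `k` of the potential in the next step. -/
noncomputable def potentialCurvature (W : NNReal → Ω' → ℝ) (P : Measure Ω') (h : ℝ) (k : ℕ)
    (s : ℕ → ℝ) : ℝ :=
  averageCurvature h fun y => tubeValue S κ hη W P (k + 1) s (s k + y)

lemma continuous_tubeValue_translate (hW : IsPreBrownianReal W P) (k : ℕ) :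
    Continuous (Function.uncurry fun (s : ℕ → ℝ) y => tubeValue S κ hη W P (k + 1) s (s k + y)) :=
  (continuous_tubeValue S κ hη hW (k + 1)).comp
    (f := fun p : (ℕ → ℝ) × ℝ => (p.1, p.1 k + p.2)) (by fun_prop)

lemma continuous_potentialSlope (hW : IsPreBrownianReal W P) (h : ℝ) (k : ℕ) :
    Continuous (potentialSlope S κ hη W P h k) := by
  have h2 := continuous_slidingAverage h (continuous_slidingAverage h
    (continuous_tubeValue_translate S κ hη hW k))
  have e := fun c : ℝ => h2.comp (f := fun s : ℕ → ℝ => (s, c)) (by fun_prop)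
  exact ((e (h / 2)).sub (e (-(h / 2)))).div_const h

lemma continuous_potentialCurvature (hW : IsPreBrownianReal W P) (h : ℝ) (k : ℕ) :
    Continuous (potentialCurvature S κ hη W P h k) := by
  have h1 := continuous_slidingAverage h (continuous_tubeValue_translate S κ hη hW k)
  have e := fun c : ℝ => h1.comp (f := fun s : ℕ → ℝ => (s, c)) (by fun_prop)
  exact (((e h).sub ((e 0).const_mul 2)).add (e (-h))).div_const (h ^ 2)

lemma continuous_tubePotential (hW : IsPreBrownianReal W P) (h : ℝ) (k : ℕ) :
    Continuous (tubePotential S κ hη W P h k) := by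
  have h3 := continuous_slidingAverage h (continuous_slidingAverage h
    (continuous_slidingAverage h (continuous_tubeValue S κ hη hW k)))
  exact h3.comp (f := fun s : ℕ → ℝ => (s, s k)) (by fun_prop)

lemma continuous_tubeValue_apply (hW : IsPreBrownianReal W P) (k : ℕ) (s : ℕ → ℝ) :
    Continuous (tubeValue S κ hη W P k s) :=
  (continuous_tubeValue S κ hη hW k).comp (f := fun v : ℝ => (s, v)) (by fun_prop)

lemma tubePotential_mem_Icc (hW : IsPreBrownianReal W P) (h : ℝ) (k : ℕ) (s : ℕ → ℝ) :
    tubePotential S κ hη W P h k s ∈ Set.Icc (0 : ℝ) 1 := by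
  have hP : IsProbabilityMeasure P := hW.isGaussianProcess.isProbabilityMeasure
  exact tripleAverage_mem_Icc h (continuous_tubeValue_apply S κ hη hW k s)
    (tubeValue_mem_Icc S κ hη k s) _

variable {κ}

/-- One step of the Lindeberg recursion for the potentials. -/
theorem tubePotential_succ_le (hW : IsPreBrownianReal W P) {h : ℝ} (hh : 0 < h)
    (hκ : 3 * h / 2 ≤ κ) (k : ℕ) (s : ℕ → ℝ) (y : ℝ) :
    tubePotential S κ hη W P h (k + 1) (Function.update s (k + 1) (s k + y)) ≤
      tubePotential S κ hη W P h k s + potentialSlope S κ hη W P h k s * y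
        + potentialCurvature S κ hη W P h k s * ((y ^ 2 - 1) / 2)
        + 2 / 3 * min (|y / h| ^ 3) (3 * |y / h| ^ 2) + 16 / 15 / h ^ 3 := by
  have hP : IsProbabilityMeasure P := hW.isGaussianProcess.isProbabilityMeasure
  set F : ℝ → ℝ := fun y => tubeValue S κ hη W P (k + 1) s (s k + y) with hF
  have hFc : Continuous F := (continuous_tubeValue_apply S κ hη hW (k + 1) s).comp
    (by fun_prop : Continuous fun y => s k + y)
  have h01 : ∀ y, F y ∈ Set.Icc (0 : ℝ) 1 := fun y => tubeValue_mem_Icc S κ hη _ _ _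
  have hG : tubePotential S κ hη W P h (k + 1) (Function.update s (k + 1) (s k + y)) =
      tripleAverage h F y := by
    rw [hF, tripleAverage_comp_const_add, tubePotential, Function.update_self]
    congr 1
    funext v
    exact tubeValue_congr S κ hη (fun j hj => Function.update_of_ne (by omega) _ _) v
  -- A Brownian step does not increase the potential: inside the averages the position stays within
  -- `κ` of `s k`, as the tube comparison requires.
  have hE : ∫ z, tripleAverage h F z ∂(gaussianReal 0 1) ≤ tubePotential S κ hη W P h k s := by
    have e : tubePotential S κ hη W P h k s =
        tripleAverage h (fun v => tubeValue S κ hη W P k s (s k + v)) 0 := by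
      simp only [tripleAverage_comp_const_add, tubePotential, add_zero]
    rw [integral_tripleAverage hFc h01, e]
    refine tripleAverage_le hh.le hκ (continuous_integral_translate hFc h01 _)
      ((continuous_tubeValue_apply S κ hη hW k s).comp
        (by fun_prop : Continuous fun y => s k + y)) fun v hv => ?_
    have := integral_tubeValue_succ_le S κ hη hW k s (u := s k + v) (by simpa using hv)
    simpa only [hF, add_assoc] using this
  have hT := (abs_le.1 (tripleAverage_taylor hh hFc h01 y)).2
  have hC := tripleAverage_add_curvature_le hh hFc h01
  rw [hG]
  change _ ≤ tubePotential S κ hη W P h k s + averageSlope h F * y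
    + averageCurvature h F * ((y ^ 2 - 1) / 2) + _ + _
  linarith

/-- The last potential dominates the indicator of the set of paths. -/
lemma tubePotential_last (hW : IsPreBrownianReal W P) {h : ℝ} (hh : 0 < h)
    (hκ : 3 * h / 2 ≤ κ) {s : ℕ → ℝ} (hs : (fun j : Fin (n + 1) => s j) ∈ S) :
    tubePotential S κ hη W P h n s = 1 := by
  have hP : IsProbabilityMeasure P := hW.isGaussianProcess.isProbabilityMeasure
  refine le_antisymm (tubePotential_mem_Icc S κ hη hW h n s).2 ?_
  have h1 : tripleAverage h (fun _ => (1 : ℝ)) (s n) = 1 := by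
    simp only [tripleAverage, slidingAverage_const]
  rw [← h1]
  refine tripleAverage_le hh.le hκ continuous_const (continuous_tubeValue_apply S κ hη hW n s)
    fun v hv => ?_
  have : ∀ ω, tubeIndicator S κ hη n (hybridPath n n W s v ω) = 1 := fun ω => by
    refine tubeIndicator_eq_one hη ⟨_, hs, fun j hj => ?_, fun j hj => ?_⟩
    · simp [hybridPath, hj]
    · have hjn : (j : ℕ) = n := by omega
      simpa [hybridPath, hjn] using hv
  simp [tubeValue, this]

/-- The initial potential is bounded by the probability that Brownian motion stays close to a path
of the set. -/
lemma tubePotential_zero_le (hW : IsPreBrownianReal W P) {h : ℝ} (hh : 0 < h)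
    (hκ : 3 * h / 2 ≤ κ) {s : ℕ → ℝ} (hs : s 0 = 0) :
    tubePotential S κ hη W P h 0 s ≤
      P.real {ω | ∃ x ∈ S, ∀ j : Fin (n + 1), |W j ω - x j| < 2 * κ + η} := by
  have hP : IsProbabilityMeasure P := hW.isGaussianProcess.isProbabilityMeasure
  set r := P.real {ω | ∃ x ∈ S, ∀ j : Fin (n + 1), |W j ω - x j| < 2 * κ + η} with hr
  have h1 : tripleAverage h (fun _ => r) (s 0) = r := by
    simp only [tripleAverage, slidingAverage_const]
  rw [← h1]
  refine tripleAverage_le hh.le hκ (continuous_tubeValue_apply S κ hη hW 0 s) continuous_const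
    fun v hv => ?_
  rw [hs, sub_zero] at hv
  set T : Set Ω' := hybridPath n 0 W s v ⁻¹' Metric.thickening η (pathTube S κ 0) with hT
  have hTm : NullMeasurableSet T P :=
    (aemeasurable_hybridPath hW 0 s v).nullMeasurable Metric.isOpen_thickening.measurableSet
  calc tubeValue S κ hη W P 0 s v ≤ ∫ ω, T.indicator (fun _ => (1 : ℝ)) ω ∂P := by
        refine integral_mono (integrable_tubeIndicator_comp S κ hη
          (aemeasurable_hybridPath hW 0 s v) 0)
          ((integrable_const (1 : ℝ)).indicator₀ hTm) fun ω => ?_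
        by_cases hω : ω ∈ T
        · rw [Set.indicator_of_mem hω]
          exact (tubeIndicator_mem_Icc S hη 0 _).2
        · rw [Set.indicator_of_notMem hω, tubeIndicator_eq_zero hη hω]
    _ = P.real T := by
        rw [integral_indicator₀ hTm]
        simp
    _ ≤ r := by
        refine ENNReal.toReal_mono (measure_ne_top _ _) (measure_mono_ae ?_)
        -- The total distance is `κ` from smoothing the starting point, `κ` from the tube, and `η`
        -- from the thickening.
        filter_upwards [hW.eval_zero_ae_eq_zero] with ω h0 hω
        obtain ⟨w, ⟨x, hx, -, hxw⟩, hd⟩ := Metric.mem_thickening_iff.1 hω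
        refine ⟨x, hx, fun j => ?_⟩
        have h2 := hxw j (Nat.zero_le _)
        have h3 : |hybridPath n 0 W s v ω j - w j| < η := (dist_le_pi_dist _ _ j).trans_lt hd
        have h4 : hybridPath n 0 W s v ω j = v + W j ω := by
          simp [hybridPath, h0]
        rw [h4] at h3
        rw [abs_le] at h2 hv
        rw [abs_lt] at h3 ⊢
        constructor <;> linarith [h2.1, h2.2, h3.1, h3.2, hv.1, hv.2]

end Potential

/-! ### From the discrete skeleton to the path of the Brownian motion -/

/-- The sequences of partial sums starting at `0` whose broken line belongs to `D`. -/
def vertexSet (n : ℕ) (D : Set C(unitInterval, ℝ)) : Set (Fin (n + 1) → ℝ) :=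
  {s | s 0 = 0 ∧ brokenLine n (fun i : Fin n => s i.succ - s i.castSucc) ∈ D}

lemma sum_Iio_succ_sub {n : ℕ} (s : Fin (n + 1) → ℝ) (k : Fin n) :
    ∑ i ∈ Finset.Iio k, (s i.succ - s i.castSucc) = s k.castSucc - s 0 := by
  set σ : ℕ → ℝ := fun j => if h : j < n + 1 then s ⟨j, h⟩ else 0 with hσ
  have h1 : ∀ i : Fin n, s i.succ - s i.castSucc = σ (i + 1) - σ i := fun i => by
    have h1 : (i : ℕ) < n := i.2
    simp only [hσ]
    rw [dif_pos (by omega), dif_pos (by omega)]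
    rfl
  have h2 : s k.castSucc - s 0 = σ k - σ 0 := by
    have h1 : (k : ℕ) < n := k.2
    simp only [hσ]
    rw [dif_pos (by omega), dif_pos (by omega)]
    rfl
  rw [h2, ← Finset.sum_range_sub, Finset.sum_congr rfl fun i _ => h1 i, ← Nat.Iio_eq_range,
    ← Fin.map_valEmbedding_Iio, Finset.sum_map]
  rfl

/-- At the time `(k + θ) / n` the broken line with vertices `s` is a convex combination. -/
lemma brokenLine_vertices_apply {n : ℕ} {s : Fin (n + 1) → ℝ} (h0 : s 0 = 0) (k : Fin n)
    (t : unitInterval) (hk0 : (k : ℕ) ≤ n * (t : ℝ)) (hk1 : n * (t : ℝ) ≤ (k : ℕ) + 1) :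
    brokenLine n (fun i : Fin n => s i.succ - s i.castSucc) t =
      (√(n : ℝ))⁻¹ * (s k.castSucc + (n * (t : ℝ) - (k : ℕ)) * (s k.succ - s k.castSucc)) := by
  rw [brokenLine_apply n _ k t hk0 hk1, sum_Iio_succ_sub, h0, sub_zero]

section Skeleton

variable {Ω' : Type*} [MeasurableSpace Ω'] {P : Measure Ω'}

lemma isBrownianReal_rescale {B : NNReal → Ω' → ℝ} (hB : IsBrownianReal B P) {n : ℕ}
    (hn : n ≠ 0) : IsBrownianReal (fun t ω => √(n : ℝ) * B (t / n) ω) P := by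
  have hc : ((n : NNReal)⁻¹) ≠ 0 := inv_ne_zero (by exact_mod_cast hn)
  convert hB.smul hc using 3 with t ω
  rw [NNReal.coe_inv, Real.sqrt_inv, inv_inv, NNReal.coe_natCast, div_eq_inv_mul]

lemma measure_bridge_shift_le {W : NNReal → Ω' → ℝ} (hW : IsBrownianReal W P) {x : ℝ}
    (hx : 0 < x) (k : ℕ) :
    P {ω | ∃ t : NNReal, t < 1 ∧ x < |W (k + t) ω - W k ω - t * (W (k + 1) ω - W k ω)|} ≤
      ENNReal.ofReal (2 * Real.exp (-(2 * x ^ 2))) :=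
  measure_bridge_le (hW.shift k) hx

/-- If the skeleton of a Brownian motion stays close to the vertices of a path of `D` and its
bridges are small, then its path belongs to a neighbourhood of `D`. -/
theorem measureReal_skeleton_le {B : NNReal → Ω' → ℝ} (hB : IsBrownianReal B P) {n : ℕ}
    (hn : 1 ≤ n) (D : Set C(unitInterval, ℝ)) {ε x c : ℝ} (hx : 0 < x)
    (hc : c + x ≤ ε * √(n : ℝ)) :
    P.real {ω | ∃ s ∈ vertexSet n D, ∀ j : Fin (n + 1),
        |√(n : ℝ) * B (((j : ℕ) : NNReal) / n) ω - s j| < c} ≤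
      P.real (pathEvent B (Metric.thickening ε D)) + n * (2 * Real.exp (-(2 * x ^ 2))) := by
  have hP : IsProbabilityMeasure P := hB.isGaussianProcess.isProbabilityMeasure
  have hn0 : (0 : ℝ) < n := by exact_mod_cast hn
  have hsq : 0 < √(n : ℝ) := Real.sqrt_pos.2 hn0
  set W : NNReal → Ω' → ℝ := fun t ω => √(n : ℝ) * B (t / n) ω with hWdef
  have hW : IsBrownianReal W P := isBrownianReal_rescale hB (by omega)
  -- The bridge over the `k`-th unit interval is large. Time 1 may be omitted because the bridge
  -- vanishes there.
  set bad : ℕ → Set Ω' := fun k =>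
    {ω | ∃ t : NNReal, t < 1 ∧ x < |W (k + t) ω - W k ω - t * (W (k + 1) ω - W k ω)|} with hbad
  have hsub : {ω | ∃ s ∈ vertexSet n D, ∀ j : Fin (n + 1),
        |√(n : ℝ) * B (((j : ℕ) : NNReal) / n) ω - s j| < c} ≤ᵐ[P]
      (pathEvent B (Metric.thickening ε D) ∪ ⋃ k ∈ Finset.range n, bad k : Set Ω') := by
    filter_upwards [hB.cont] with ω hcont
    rintro ⟨s, ⟨hs0, hsD⟩, hs⟩
    by_contra hω
    have hω1 : ω ∉ pathEvent B (Metric.thickening ε D) := fun h => hω (Or.inl h)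
    have hω2 : ω ∉ ⋃ k ∈ Finset.range n, bad k := fun h => hω (Or.inr h)
    simp only [Set.mem_iUnion, not_exists, Finset.mem_range] at hω2
    refine hω1 ⟨⟨fun t => B (unitInterval.toNNReal t) ω, hcont.comp (by fun_prop)⟩, ?_,
      fun t => rfl⟩
    refine Metric.mem_thickening_iff.2 ⟨_, hsD, ?_⟩
    rw [ContinuousMap.dist_lt_iff_of_nonempty]
    intro t
    obtain ⟨k, hk0, hk1⟩ : ∃ k : Fin n, ((k : ℕ) : ℝ) ≤ n * (t : ℝ) ∧
        n * (t : ℝ) ≤ (k : ℕ) + 1 := by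
      -- The interval index is the integer part of `n t`, except that `t = 1` belongs to the last
      -- interval.
      have ht0 := t.2.1
      rcases t.2.2.eq_or_lt with h | h
      · refine ⟨⟨n - 1, by omega⟩, ?_, ?_⟩ <;>
        · simp only [h, Nat.cast_sub hn]
          norm_num
      · have h1 : n * (t : ℝ) < n := by nlinarith
        refine ⟨⟨⌊n * (t : ℝ)⌋₊, (Nat.floor_lt (by positivity)).2 h1⟩,
          Nat.floor_le (by positivity), (Nat.lt_floor_add_one _).le⟩
    set θ : ℝ := n * (t : ℝ) - (k : ℕ) with hθ
    have hθ0 : 0 ≤ θ := by linarith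
    have hθ1 : θ ≤ 1 := by linarith
    set τ : NNReal := ⟨θ, hθ0⟩ with hτ
    have hnt : unitInterval.toNNReal t = ((k : ℕ) + τ) / n := by
      rw [← NNReal.coe_inj]
      push_cast
      change (t : ℝ) = ((k : ℕ) + θ) / n
      rw [hθ]
      field_simp
      ring
    have hBt : √(n : ℝ) * B (unitInterval.toNNReal t) ω = W ((k : ℕ) + τ) ω := by
      rw [hnt]
    have hbr : |W ((k : ℕ) + τ) ω - W (k : ℕ) ω
        - θ * (W ((k : ℕ) + 1) ω - W (k : ℕ) ω)| ≤ x := by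
      rcases hθ1.eq_or_lt with h | h
      · have hτ1 : τ = 1 := by
          rw [← NNReal.coe_inj]; exact h
        rw [hτ1, h, one_mul, sub_self, abs_zero]
        exact hx.le
      · by_contra hlt
        refine hω2 k k.2 ⟨τ, ?_, not_le.1 hlt⟩
        exact_mod_cast (show (τ : ℝ) < 1 from h)
    have hv0 : |W (k : ℕ) ω - s k.castSucc| < c := hs k.castSucc
    have hv1 : |W ((k : ℕ) + 1) ω - s k.succ| < c := by
      have := hs k.succ
      simpa [hWdef] using this
    have hlt : |W ((k : ℕ) + τ) ω - (s k.castSucc + θ * (s k.succ - s k.castSucc))| < c + x := by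
      have e : W ((k : ℕ) + τ) ω - (s k.castSucc + θ * (s k.succ - s k.castSucc)) =
          (1 - θ) * (W (k : ℕ) ω - s k.castSucc) + θ * (W ((k : ℕ) + 1) ω - s k.succ) +
          (W ((k : ℕ) + τ) ω - W (k : ℕ) ω - θ * (W ((k : ℕ) + 1) ω - W (k : ℕ) ω)) := by ring
      -- On the chord the error is a convex combination of the two vertex errors; the bridge adds at
      -- most `x`.
      have hconv := (convex_ball (0 : ℝ) c) (mem_ball_zero_iff.2 hv0) (mem_ball_zero_iff.2 hv1)
        (sub_nonneg.2 hθ1) hθ0 (sub_add_cancel 1 θ)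
      rw [e]
      exact (abs_add_le _ _).trans_lt (add_lt_add_of_lt_of_le (mem_ball_zero_iff.1 hconv) hbr)
    rw [brokenLine_vertices_apply hs0 k t hk0 hk1, Real.dist_eq]
    have e : B (unitInterval.toNNReal t) ω
        - (√(n : ℝ))⁻¹ * (s k.castSucc + θ * (s k.succ - s k.castSucc)) =
        (√(n : ℝ))⁻¹ *
          (W ((k : ℕ) + τ) ω - (s k.castSucc + θ * (s k.succ - s k.castSucc))) := by
      rw [← hBt]
      field_simp
    change |B (unitInterval.toNNReal t) ω
        - (√(n : ℝ))⁻¹ * (s k.castSucc + θ * (s k.succ - s k.castSucc))| < ε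
    rw [e, abs_mul, abs_of_pos (inv_pos.2 hsq), inv_mul_lt_iff₀ hsq, mul_comm (√(n : ℝ)) ε]
    exact hlt.trans_le hc
  have hbadle : ∀ k, P.real (bad k) ≤ 2 * Real.exp (-(2 * x ^ 2)) := fun k =>
    ENNReal.toReal_le_of_le_ofReal (by positivity) (measure_bridge_shift_le hW hx k)
  calc _ ≤ P.real (pathEvent B (Metric.thickening ε D) ∪ ⋃ k ∈ Finset.range n, bad k) :=
        ENNReal.toReal_mono (measure_ne_top _ _) (measure_mono_ae hsub)
    _ ≤ P.real (pathEvent B (Metric.thickening ε D)) + P.real (⋃ k ∈ Finset.range n, bad k) :=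
        measureReal_union_le _ _
    _ ≤ _ := by
        gcongr
        refine (measureReal_biUnion_finset_le _ _).trans
          ((Finset.sum_le_sum fun k _ => hbadle k).trans_eq ?_)
        simp

end Skeleton

namespace SublinearExpectation

/-! ### Elementary properties of sublinear expectations -/

section Basic

variable {Ω : Type*} {𝔼 : SublinearExpectation Ω}

lemma E_add_const {Y : Ω → ℝ} (hY : Y ∈ 𝔼.dom) (c : ℝ) :
    𝔼.E (fun ω => Y ω + c) = 𝔼.E Y + c := by
  have hm : ∀ {Z : Ω → ℝ} (c : ℝ), Z ∈ 𝔼.dom → (fun ω => Z ω + c) ∈ 𝔼.dom := fun c hZ =>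
    𝔼.dom.add_mem hZ (𝔼.const_mem c)
  have hle : ∀ {Z : Ω → ℝ} (c : ℝ), Z ∈ 𝔼.dom → 𝔼.E (fun ω => Z ω + c) ≤ 𝔼.E Z + c :=
    fun {Z} c hZ => by
      have := 𝔼.subadd Z hZ _ (𝔼.const_mem c)
      rwa [𝔼.const c] at this
  refine le_antisymm (hle c hY) ?_
  have := hle (-c) (hm c hY)
  simp only [add_neg_cancel_right] at this
  change 𝔼.E Y ≤ _ at this
  linarith

lemma E_const_mul {Y : Ω → ℝ} (hY : Y ∈ 𝔼.dom) {c : ℝ} (hc : 0 ≤ c) :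
    𝔼.E (fun ω => c * Y ω) = c * 𝔼.E Y :=
  𝔼.pos_homog Y hY c hc

lemma const_mul_mem {Y : Ω → ℝ} (hY : Y ∈ 𝔼.dom) (c : ℝ) : (fun ω => c * Y ω) ∈ 𝔼.dom :=
  𝔼.dom.smul_mem c hY

lemma add_const_mem {Y : Ω → ℝ} (hY : Y ∈ 𝔼.dom) (c : ℝ) : (fun ω => Y ω + c) ∈ 𝔼.dom :=
  𝔼.dom.add_mem hY (𝔼.const_mem c)

lemma add_const_mul_mem {Y Z : Ω → ℝ} (hY : Y ∈ 𝔼.dom) (hZ : Z ∈ 𝔼.dom) (c : ℝ) :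
    (fun ω => Y ω + c * Z ω) ∈ 𝔼.dom :=
  𝔼.dom.add_mem hY (const_mul_mem hZ c)

lemma E_nonneg {Y : Ω → ℝ} (hY : Y ∈ 𝔼.dom) (h0 : ∀ ω, 0 ≤ Y ω) : 0 ≤ 𝔼.E Y := by
  rw [← 𝔼.const 0]
  exact 𝔼.mono _ (𝔼.const_mem 0) _ hY h0

lemma lowerE_nonneg {Y : Ω → ℝ} (hY : Y ∈ 𝔼.dom) (h0 : ∀ ω, 0 ≤ Y ω) : 0 ≤ 𝔼.lowerE Y := by
  have := 𝔼.mono _ (𝔼.dom.neg_mem hY) _ (𝔼.const_mem 0) (fun ω => by simpa using h0 ω)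
  rw [𝔼.const 0] at this
  rw [lowerE]
  linarith

lemma lowerE_le_E {Y : Ω → ℝ} (hY : Y ∈ 𝔼.dom) : 𝔼.lowerE Y ≤ 𝔼.E Y :=
  Set.nonempty_Icc.1 (nonempty_meanInterval hY)

lemma E_add_const_mul_le {Y Z : Ω → ℝ} (hY : Y ∈ 𝔼.dom) (hZ : Z ∈ 𝔼.dom) (c : ℝ) :
    𝔼.E (fun ω => Y ω + c * Z ω) ≤ 𝔼.E Y + |c| * (|𝔼.E Z| + |𝔼.E (-Z)|) := by
  refine (𝔼.subadd Y hY _ (const_mul_mem hZ c)).trans (add_le_add le_rfl ?_)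
  rcases le_total 0 c with h | h
  · rw [E_const_mul hZ h, abs_of_nonneg h]
    exact mul_le_mul_of_nonneg_left ((le_abs_self _).trans (le_add_of_nonneg_right (abs_nonneg _))) h
  · have e : (fun ω => c * Z ω) = fun ω => (-c) * (-Z) ω := by
      funext ω; simp
    rw [e, E_const_mul (𝔼.dom.neg_mem hZ) (by linarith), abs_of_nonpos h]
    exact mul_le_mul_of_nonneg_left ((le_abs_self _).trans (le_add_of_nonneg_left (abs_nonneg _)))
      (by linarith)

/-- Sub-additivity makes this Lipschitz in `c`. Continuity of the extreme variances in the mean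
follows by expanding the square. -/
lemma continuous_E_add_const_mul {Y Z : Ω → ℝ} (hY : Y ∈ 𝔼.dom) (hZ : Z ∈ 𝔼.dom) :
    Continuous fun c : ℝ => 𝔼.E (fun ω => Y ω + c * Z ω) := by
  set K := |𝔼.E Z| + |𝔼.E (-Z)| with hK
  have hK0 : 0 ≤ K := by positivity
  have h1 : ∀ c c' : ℝ, 𝔼.E (fun ω => Y ω + c * Z ω) ≤
      𝔼.E (fun ω => Y ω + c' * Z ω) + |c - c'| * K := by
    intro c c'
    have := E_add_const_mul_le (add_const_mul_mem hY hZ c') hZ (c - c')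
    convert this using 2
    funext ω
    ring
  refine (LipschitzWith.of_le_add_mul K.toNNReal fun c c' => ?_).continuous
  rw [Real.coe_toNNReal _ hK0, Real.dist_eq, mul_comm]
  exact h1 c c'

variable {X₀ : Ω → ℝ}

lemma continuous_E_sq_sub (h : X₀ ∈ 𝔼.dom) (h2 : (fun ω => X₀ ω ^ 2) ∈ 𝔼.dom) :
    Continuous fun μ : ℝ => 𝔼.E (fun ω => (X₀ ω - μ) ^ 2) := by
  have e : ∀ μ : ℝ, 𝔼.E (fun ω => (X₀ ω - μ) ^ 2) =
      𝔼.E (fun ω => X₀ ω ^ 2 + (-2 * μ) * X₀ ω) + μ ^ 2 := fun μ => by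
    rw [← E_add_const (add_const_mul_mem h2 h _)]
    congr 1
    funext ω
    ring
  simp_rw [e]
  exact ((continuous_E_add_const_mul h2 h).comp (by fun_prop : Continuous fun μ : ℝ => -2 * μ)).add
    (by fun_prop)

lemma continuous_lowerE_sq_sub (h : X₀ ∈ 𝔼.dom) (h2 : (fun ω => X₀ ω ^ 2) ∈ 𝔼.dom) :
    Continuous fun μ : ℝ => 𝔼.lowerE (fun ω => (X₀ ω - μ) ^ 2) := by
  have h2' : (fun ω => -X₀ ω ^ 2) ∈ 𝔼.dom := 𝔼.dom.neg_mem h2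
  have e : ∀ μ : ℝ, 𝔼.lowerE (fun ω => (X₀ ω - μ) ^ 2) =
      -(𝔼.E (fun ω => -X₀ ω ^ 2 + (2 * μ) * X₀ ω) + -μ ^ 2) := fun μ => by
    rw [lowerE, ← E_add_const (add_const_mul_mem h2' h _)]
    congr 2
    funext ω
    simp only [Pi.neg_apply]
    ring
  simp_rw [e]
  exact (((continuous_E_add_const_mul h2' h).comp
    (by fun_prop : Continuous fun μ : ℝ => 2 * μ)).add (by fun_prop)).neg

lemma lowerSigma_le_lowerSD {μ : ℝ} (hμ : μ ∈ 𝔼.meanInterval X₀) :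
    𝔼.lowerSigma X₀ ≤ 𝔼.lowerSD X₀ μ := by
  refine csInf_le ⟨0, ?_⟩ (Set.mem_image_of_mem _ hμ)
  rintro _ ⟨ν, -, rfl⟩
  exact Real.sqrt_nonneg _

lemma upperSD_le_upperSigma (h : X₀ ∈ 𝔼.dom) (h2 : (fun ω => X₀ ω ^ 2) ∈ 𝔼.dom) {μ : ℝ}
    (hμ : μ ∈ 𝔼.meanInterval X₀) : 𝔼.upperSD X₀ μ ≤ 𝔼.upperSigma X₀ :=
  le_csSup (bddAbove_upperSD h h2) (Set.mem_image_of_mem _ hμ)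

end Basic

/-! ### Continuous selection of means and standard deviations -/

/-- A continuous function equal to `0` on `(-∞, -δ]` and to `1` on `[δ, ∞)`. -/
noncomputable def ramp (δ r : ℝ) : ℝ := max 0 (min 1 ((r / δ + 1) / 2))

lemma continuous_ramp (δ : ℝ) : Continuous (ramp δ) := by
  unfold ramp
  fun_prop

lemma ramp_mem_Icc (δ r : ℝ) : ramp δ r ∈ Set.Icc (0 : ℝ) 1 :=
  ⟨le_max_left _ _, max_le zero_le_one (min_le_left _ _)⟩

/-- The ramp misses its extreme value only where `r < δ`, so the loss from a continuous switch is at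
most `δ`. -/
lemma mul_one_sub_ramp_le {δ r : ℝ} (hδ : 0 < δ) (hr : 0 ≤ r) : r * (1 - ramp δ r) ≤ δ := by
  have h01 := ramp_mem_Icc δ r
  rcases le_total r δ with h | h
  · nlinarith [h01.1, h01.2]
  · have h1 : 1 ≤ r / δ := (one_le_div hδ).2 h
    have : ramp δ r = 1 := by
      rw [ramp, min_eq_left (by linarith), max_eq_right zero_le_one]
    rw [this, sub_self, mul_zero]
    exact hδ.le

lemma neg_mul_ramp_le {δ r : ℝ} (hδ : 0 < δ) (hr : r ≤ 0) : -r * ramp δ r ≤ δ := by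
  have h01 := ramp_mem_Icc δ r
  rcases le_total (-δ) r with h | h
  · nlinarith [h01.1, h01.2]
  · have h1 : r / δ ≤ -1 := by
      rw [div_le_iff₀ hδ]
      linarith
    have : ramp δ r = 0 := by
      rw [ramp, max_eq_left]
      exact (min_le_right _ _).trans (by linarith)
    rw [this, mul_zero]
    exact hδ.le

section Selection

variable {Ω : Type*} {𝔼 : SublinearExpectation Ω} {X₀ : Ω → ℝ}

/-- For all coefficients of a quadratic polynomial, depending continuously on a parameter, the mean
and the standard deviation can be chosen continuously so that the polynomial of the standardized
variable has almost nonpositive upper expectation. -/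
theorem exists_selection (h : X₀ ∈ 𝔼.dom) (h2 : (fun ω => X₀ ω ^ 2) ∈ 𝔼.dom)
    (hσ : 0 < 𝔼.lowerSigma X₀) {α : Type*} [TopologicalSpace α] {a b : α → ℝ}
    (ha : Continuous a) (hb : Continuous b) {δ : ℝ} (hδ : 0 < δ) :
    ∃ M V : α → ℝ, Continuous M ∧ Continuous V ∧ (∀ x, M x ∈ 𝔼.meanInterval X₀) ∧
      (∀ x, 𝔼.lowerSD X₀ (M x) ≤ V x) ∧ (∀ x, V x ≤ 𝔼.upperSD X₀ (M x)) ∧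
      ∀ x, (fun ω => a x * ((X₀ ω - M x) / V x) + b x * ((((X₀ ω - M x) / V x) ^ 2 - 1) / 2))
          ∈ 𝔼.dom ∧
        𝔼.E (fun ω => a x * ((X₀ ω - M x) / V x)
          + b x * ((((X₀ ω - M x) / V x) ^ 2 - 1) / 2)) ≤ δ := by
  set l := 𝔼.lowerSigma X₀ with hl
  set lo := 𝔼.lowerE X₀ with hlo
  set hi := 𝔼.E X₀ with hhi
  set v := 𝔼.upperSigma X₀ ^ 2 with hv
  have hK : 0 ≤ hi - lo := sub_nonneg.2 (lowerE_le_E h)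
  -- The linear part will cost at most `δ₁ (hi - lo) / l` and the quadratic part `δ₁ v / (2 l²)`;
  -- the summand 1 keeps the denominator positive.
  set δ₁ := δ / ((hi - lo) / l + v / l ^ 2 + 1) with hδ₁
  have hden : 0 < (hi - lo) / l + v / l ^ 2 + 1 := by positivity
  have hδ₁0 : 0 < δ₁ := div_pos hδ hden
  have hδ₁δ : δ₁ * ((hi - lo) / l) + δ₁ * (v / l ^ 2) / 2 ≤ δ := by
    have e : δ₁ * ((hi - lo) / l + v / l ^ 2 + 1) = δ := div_mul_cancel₀ _ hden.ne'
    have : 0 ≤ δ₁ * (v / l ^ 2) := by positivity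
    nlinarith
  -- The upper mean annihilates the upper expectation of the linear term for `a > 0`, the lower mean
  -- for `a < 0`; the ramp interpolates.
  set M : α → ℝ := fun x => lo + ramp δ₁ (a x) * (hi - lo) with hM
  have hMc : Continuous M := by
    have := (continuous_ramp δ₁).comp ha
    exact continuous_const.add (this.mul continuous_const)
  have hMmem : ∀ x, M x ∈ 𝔼.meanInterval X₀ := fun x => by
    have h01 := ramp_mem_Icc δ₁ (a x)
    constructor
    · have := mul_nonneg h01.1 hK
      simp only [hM, ← hlo]
      linarith
    · have := mul_le_of_le_one_left hK h01.2
      simp only [hM, ← hhi]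
      linarith
  set low : α → ℝ := fun x => 𝔼.lowerE (fun ω => (X₀ ω - M x) ^ 2) with hlow
  set up : α → ℝ := fun x => 𝔼.E (fun ω => (X₀ ω - M x) ^ 2) with hup
  have hlc : Continuous low := (continuous_lowerE_sq_sub h h2).comp hMc
  have huc : Continuous up := (continuous_E_sq_sub h h2).comp hMc
  -- The same switch for the variance about the mean already chosen, governed by the sign of `b`.
  set q : α → ℝ := fun x => low x + ramp δ₁ (b x) * (up x - low x) with hq
  have hqc : Continuous q := hlc.add (((continuous_ramp δ₁).comp hb).mul (huc.sub hlc))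
  have hlu : ∀ x, low x ≤ up x := fun x => lowerE_le_E (sq_sub_mem h h2 (M x))
  have hlowq : ∀ x, low x ≤ q x := fun x =>
    le_add_of_nonneg_right (mul_nonneg (ramp_mem_Icc _ _).1 (sub_nonneg.2 (hlu x)))
  have hqup : ∀ x, q x ≤ up x := fun x => by
    have := mul_le_of_le_one_left (sub_nonneg.2 (hlu x)) (ramp_mem_Icc δ₁ (b x)).2
    simp only [hq]
    linarith
  have hlow0 : ∀ x, 0 ≤ low x := fun x =>
    lowerE_nonneg (sq_sub_mem h h2 (M x)) fun ω => sq_nonneg _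
  have hl_low : ∀ x, l ^ 2 ≤ low x := fun x => by
    have := lowerSigma_le_lowerSD (hMmem x)
    rw [lowerSD, Real.le_sqrt' hσ] at this
    exact this
  have hup_v : ∀ x, up x ≤ v := fun x => by
    have h1 := upperSD_le_upperSigma h h2 (hMmem x)
    have h0 : 0 ≤ up x := (hlow0 x).trans (hlu x)
    calc up x = 𝔼.upperSD X₀ (M x) ^ 2 := (Real.sq_sqrt h0).symm
      _ ≤ v := by
        rw [hv]
        exact pow_le_pow_left₀ (Real.sqrt_nonneg _) h1 2
  refine ⟨M, fun x => √(q x), hMc, hqc.sqrt, hMmem, fun x => Real.sqrt_le_sqrt (hlowq x),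
    fun x => Real.sqrt_le_sqrt (hqup x), fun x => ?_⟩
  have hq0 : 0 < q x := (pow_pos hσ 2).trans_le ((hl_low x).trans (hlowq x))
  have hs0 : 0 < √(q x) := Real.sqrt_pos.2 hq0
  have hls : l ≤ √(q x) := (Real.le_sqrt' hσ).2 ((hl_low x).trans (hlowq x))
  have hm1 : (fun ω => a x * ((X₀ ω - M x) / √(q x))) ∈ 𝔼.dom := by
    convert const_mul_mem (add_const_mem h (-M x)) (a x / √(q x)) using 1
    funext ω
    ring
  have hm2 : (fun ω => b x * ((((X₀ ω - M x) / √(q x)) ^ 2 - 1) / 2)) ∈ 𝔼.dom := by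
    convert add_const_mem (const_mul_mem (sq_sub_mem h h2 (M x)) (b x / (2 * q x))) (-(b x / 2))
      using 1
    funext ω
    rw [div_pow, Real.sq_sqrt hq0.le]
    field_simp
    ring
  refine ⟨𝔼.dom.add_mem hm1 hm2, (𝔼.subadd _ hm1 _ hm2).trans (le_trans (add_le_add ?_ ?_) hδ₁δ)⟩
  · have hfin : ∀ w : ℝ, 0 ≤ w → w ≤ δ₁ →
        w * (hi - lo) / √(q x) ≤ δ₁ * ((hi - lo) / l) := fun w hw0 hw => by
      rw [mul_div_assoc]
      exact mul_le_mul hw (div_le_div_of_nonneg_left hK hσ hls) (by positivity) hδ₁0.le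
    rcases le_total 0 (a x) with h0 | h0
    · have e : (fun ω => a x * ((X₀ ω - M x) / √(q x))) =
          fun ω => (a x / √(q x)) * (X₀ ω + -M x) := by
        funext ω; ring
      rw [e, E_const_mul (add_const_mem h _) (by positivity), E_add_const h]
      refine le_trans (le_of_eq ?_) (hfin _ (mul_nonneg h0 (sub_nonneg.2 (ramp_mem_Icc δ₁ (a x)).2))
        (mul_one_sub_ramp_le hδ₁0 h0))
      simp only [hM, ← hhi]
      ring
    · have e : (fun ω => a x * ((X₀ ω - M x) / √(q x))) =
          fun ω => (-a x / √(q x)) * ((-X₀) ω + M x) := by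
        funext ω
        simp only [Pi.neg_apply]
        ring
      rw [e, E_const_mul (add_const_mem (𝔼.dom.neg_mem h) _)
        (div_nonneg (by linarith) hs0.le), E_add_const (𝔼.dom.neg_mem h)]
      refine le_trans (le_of_eq ?_) (hfin _ (mul_nonneg (by linarith) (ramp_mem_Icc δ₁ (a x)).1)
        (neg_mul_ramp_le hδ₁0 h0))
      have : 𝔼.E (-X₀) = -lo := by rw [hlo, lowerE, neg_neg]
      simp only [hM, this]
      ring
  · have hfin : ∀ w : ℝ, 0 ≤ w → w ≤ δ₁ →
        w * (up x - low x) / (2 * q x) ≤ δ₁ * (v / l ^ 2) / 2 := fun w hw0 hw => by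
      have h1 : (up x - low x) / q x ≤ v / l ^ 2 := by
        refine div_le_div₀ (sq_nonneg _) ?_ (pow_pos hσ 2) ((hl_low x).trans (hlowq x))
        linarith [hup_v x, hlow0 x]
      have h2 : 0 ≤ (up x - low x) / q x := div_nonneg (sub_nonneg.2 (hlu x)) hq0.le
      calc w * (up x - low x) / (2 * q x) = w * ((up x - low x) / q x) / 2 := by
            field_simp
        _ ≤ δ₁ * (v / l ^ 2) / 2 := by gcongr
    have hY := sq_sub_mem h h2 (M x)
    rcases le_total 0 (b x) with h0 | h0
    · have e : (fun ω => b x * ((((X₀ ω - M x) / √(q x)) ^ 2 - 1) / 2)) =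
          fun ω => (b x / (2 * q x)) * ((X₀ ω - M x) ^ 2 + -q x) := by
        funext ω
        rw [div_pow, Real.sq_sqrt hq0.le]
        field_simp
        ring
      rw [e, E_const_mul (add_const_mem hY _) (by positivity), E_add_const hY]
      refine le_trans (le_of_eq ?_) (hfin _ (mul_nonneg h0 (sub_nonneg.2 (ramp_mem_Icc δ₁ (b x)).2))
        (mul_one_sub_ramp_le hδ₁0 h0))
      change b x / (2 * q x) * (up x + -q x) = _
      have : up x + -q x = (1 - ramp δ₁ (b x)) * (up x - low x) := by
        simp only [hq]; ring
      rw [this]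
      ring
    · have e : (fun ω => b x * ((((X₀ ω - M x) / √(q x)) ^ 2 - 1) / 2)) =
          fun ω => (-b x / (2 * q x)) * ((-fun ω => (X₀ ω - M x) ^ 2) ω + q x) := by
        funext ω
        rw [div_pow, Real.sq_sqrt hq0.le]
        simp only [Pi.neg_apply]
        field_simp
        ring
      rw [e, E_const_mul (add_const_mem (𝔼.dom.neg_mem hY) _)
        (div_nonneg (by linarith) (by positivity)), E_add_const (𝔼.dom.neg_mem hY)]
      refine le_trans (le_of_eq ?_) (hfin _ (mul_nonneg (by linarith) (ramp_mem_Icc δ₁ (b x)).1)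
        (neg_mul_ramp_le hδ₁0 h0))
      have h3 : 𝔼.E (-fun ω => (X₀ ω - M x) ^ 2) = -low x := by
        simp only [hlow]
        rw [lowerE, neg_neg]
      have h4 : -low x + q x = ramp δ₁ (b x) * (up x - low x) := by
        simp only [hq]; ring
      rw [h3, h4]
      ring

/-- An upper bound for the expectation of a function dominated by a quadratic polynomial and a
multiple of a function with finite upper extension. -/
lemma E_le_of_le_add_extE {Y Q F : Ω → ℝ} (hY : Y ∈ 𝔼.dom) (hQ : Q ∈ 𝔼.dom) {A γ : ℝ}
    (hA : 0 ≤ A) (hF : 𝔼.extE F ≤ (γ : EReal)) {c δ : ℝ} (hQδ : 𝔼.E Q ≤ δ)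
    (hle : ∀ ω, Y ω ≤ c + Q ω + A * F ω) : 𝔼.E Y ≤ c + δ + A * γ := by
  refine le_of_forall_pos_le_add fun e he => ?_
  -- The denominator `A + 1` allows `A = 0`.
  have hlt : 𝔼.extE F < ((γ + e / (A + 1) : ℝ) : EReal) :=
    hF.trans_lt (by exact_mod_cast lt_add_of_pos_right γ (by positivity))
  simp only [extE, iInf_lt_iff] at hlt
  obtain ⟨Z, ⟨hZ, hFZ⟩, hEZ⟩ := hlt
  have hEZ' : 𝔼.E Z < γ + e / (A + 1) := by exact_mod_cast hEZ
  have hAZ := const_mul_mem hZ A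
  calc 𝔼.E Y ≤ 𝔼.E (fun ω => (Q + fun ω => A * Z ω) ω + c) := by
        refine 𝔼.mono _ hY _ (add_const_mem (𝔼.dom.add_mem hQ hAZ) c) fun ω => (hle ω).trans ?_
        have := mul_le_mul_of_nonneg_left (hFZ ω) hA
        simp only [Pi.add_apply]
        linarith
    _ = 𝔼.E (Q + fun ω => A * Z ω) + c := E_add_const (𝔼.dom.add_mem hQ hAZ) c
    _ ≤ δ + A * (γ + e / (A + 1)) + c := by
        have := 𝔼.subadd Q hQ _ hAZ
        rw [E_const_mul hZ hA] at this
        have := mul_le_mul_of_nonneg_left hEZ'.le hA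
        linarith
    _ ≤ c + δ + A * γ + e := by
        have : A * (e / (A + 1)) ≤ e := by
          rw [mul_div_assoc', div_le_iff₀ (by positivity)]
          nlinarith
        linarith

end Selection

end SublinearExpectation

/-! ### Adapted standardized partial sums -/

/-- The sequence `0, s₁, …, s_k, 0, …` of the partial sums of `(x_i - M_i) / V_i`, where `M_i` and
`V_i` are evaluated at the preceding partial sums. -/
noncomputable def standardizedSums (M V : ℕ → (ℕ → ℝ) → ℝ) : ℕ → (ℕ → ℝ) → ℕ → ℝ
  | 0, _ => 0
  | k + 1, x => Function.update (standardizedSums M V k x) (k + 1)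
      (standardizedSums M V k x k +
        (x k - M k (standardizedSums M V k x)) / V k (standardizedSums M V k x))

section StandardizedSums

variable {M V : ℕ → (ℕ → ℝ) → ℝ}

lemma standardizedSums_congr {k : ℕ} {x x' : ℕ → ℝ} (h : ∀ j < k, x j = x' j) :
    standardizedSums M V k x = standardizedSums M V k x' := by
  induction k with
  | zero => rfl
  | succ k ih =>
    simp only [standardizedSums, ih fun j hj => h j (by omega), h k (by omega)]

lemma standardizedSums_apply_of_le {k j : ℕ} (hj : j ≤ k) (x : ℕ → ℝ) :
    standardizedSums M V k x j = standardizedSums M V j x j := by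
  induction k with
  | zero => rw [Nat.le_zero.1 hj]
  | succ k ih =>
    rcases hj.eq_or_lt with h | h
    · rw [h]
    · rw [standardizedSums, Function.update_of_ne (by omega), ih (by omega)]

lemma standardizedSums_succ_sub {n i : ℕ} (hi : i < n) (x : ℕ → ℝ) :
    standardizedSums M V n x (i + 1) - standardizedSums M V n x i =
      (x i - M i (standardizedSums M V i x)) / V i (standardizedSums M V i x) := by
  rw [standardizedSums_apply_of_le (show i + 1 ≤ n by omega),
    standardizedSums_apply_of_le (show i ≤ n by omega), standardizedSums, Function.update_self]
  ring

lemma continuous_standardizedSums {n : ℕ} (hM : ∀ k < n, Continuous (M k))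
    (hV : ∀ k < n, Continuous (V k)) (hV0 : ∀ k < n, ∀ s, V k s ≠ 0) {k : ℕ} (hk : k ≤ n) :
    Continuous (standardizedSums M V k) := by
  induction k with
  | zero => exact continuous_const
  | succ k ih =>
    have ih := ih (by omega)
    refine ih.update (k + 1) (((continuous_apply k).comp ih).add (Continuous.div ?_ ?_ ?_))
    · exact (continuous_apply k).sub ((hM k (by omega)).comp ih)
    · exact (hV k (by omega)).comp ih
    · exact fun x => hV0 k (by omega) _

end StandardizedSums

/-- The extension of a finite sequence by zeros. -/
def extendZero {k : ℕ} (y : Fin k → ℝ) (j : ℕ) : ℝ := if h : j < k then y ⟨j, h⟩ else 0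

lemma continuous_extendZero {k : ℕ} : Continuous (extendZero : (Fin k → ℝ) → ℕ → ℝ) := by
  refine continuous_pi fun j => ?_
  unfold extendZero
  split_ifs <;> fun_prop

lemma extendZero_apply_of_lt {k j : ℕ} (x : ℕ → ℝ) (h : j < k) :
    extendZero (fun i : Fin k => x i) j = x j := by
  rw [extendZero, dif_pos h]

/-- Division of the truncated moment by `C ^ p`. -/
lemma min_rpow_eq {p C t : ℝ} (hC : 0 < C) :
    min (|t| ^ p) (C ^ (p - 2) * t ^ 2) = C ^ p * min ((|t| / C) ^ p) ((|t| / C) ^ 2) := by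
  rw [mul_min_of_nonneg _ _ (Real.rpow_nonneg hC.le p), Real.div_rpow (abs_nonneg t) hC.le,
    Real.rpow_sub hC, div_pow, sq_abs, Real.rpow_two]
  have := Real.rpow_pos_of_pos hC p
  congr 1 <;> field_simp

namespace SublinearExpectation

/-! ### Iterated expectations of i.i.d. sequences -/

section Iterate

variable {Ω : Type*} {𝔼 : SublinearExpectation Ω} {X₀ : Ω → ℝ} {X : ℕ → Ω → ℝ}

/-- If each step of a sequence of bounded continuous functions of the past increases the expectation
by at most `e`, then `k` steps increase it by at most `k e`. -/
theorem E_iterate_le (hX : 𝔼.IsIIDWith X X₀) {n : ℕ} {U : ℕ → (ℕ → ℝ) → ℝ} {e : ℝ}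
    (hUc : ∀ k ≤ n, Continuous (U k)) (hU01 : ∀ k x, U k x ∈ Set.Icc (0 : ℝ) 1)
    (hUcongr : ∀ k x x', (∀ j < k, x j = x' j) → U k x = U k x')
    (hstep : ∀ k < n, ∀ x : ℕ → ℝ,
      (fun ω => U (k + 1) (Function.update x k (X₀ ω))) ∈ 𝔼.dom →
      𝔼.E (fun ω => U (k + 1) (Function.update x k (X₀ ω))) ≤ U k x + e)
    {k : ℕ} (hk : 1 ≤ k) (hkn : k ≤ n) :
    (fun ω => U k fun j => X j ω) ∈ 𝔼.dom ∧
      𝔼.E (fun ω => U k fun j => X j ω) ≤ U 0 0 + k * e := by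
  have hbound : ∀ k x, ‖U k x‖ ≤ 1 := fun k x => by
    rw [Real.norm_of_nonneg (hU01 k x).1]
    exact (hU01 k x).2
  -- Identical distribution transfers the one-step bound from `X₀` to `X k` with the past frozen at
  -- a deterministic `x`; independence later inserts the random past.
  have hid : ∀ k < n, ∀ x : ℕ → ℝ,
      𝔼.E (fun ω => U (k + 1) (Function.update x k (X k ω))) ≤ U k x + e := by
    intro k hk x
    have hc : Continuous fun y : ℝ => U (k + 1) (Function.update x k y) :=
      (hUc (k + 1) (by omega)).comp (continuous_const.update k continuous_id)
    obtain ⟨-, h2, h3⟩ := hX.1 k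
      (BoundedContinuousFunction.ofNormedAddCommGroup _ hc 1 fun y => hbound _ _)
    exact h3.le.trans (hstep k hk x h2)
  induction k, hk using Nat.le_induction with
  | base =>
    have e1 : (fun ω => U 1 fun j => X j ω) = fun ω => U 1 (Function.update 0 0 (X 0 ω)) := by
      funext ω
      refine hUcongr 1 _ _ fun j hj => ?_
      rw [Nat.lt_one_iff.1 hj, Function.update_self]
    have hc : Continuous fun y : ℝ => U 1 (Function.update 0 0 y) :=
      (hUc 1 hkn).comp (continuous_const.update 0 continuous_id)
    obtain ⟨h1, -, -⟩ := hX.1 0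
      (BoundedContinuousFunction.ofNormedAddCommGroup _ hc 1 fun y => hbound _ _)
    rw [e1]
    refine ⟨h1, (hid 0 (by omega) 0).trans_eq ?_⟩
    simp
  | succ k hk ih =>
    obtain ⟨ih1, ih2⟩ := ih (by omega)
    -- Independence is stated for test functions of the finite past, so the past is padded with
    -- zeros; the values of `U` do not notice.
    have hc : Continuous fun q : (Fin k → ℝ) × ℝ =>
        U (k + 1) (Function.update (extendZero q.1) k q.2) :=
      (hUc (k + 1) hkn).comp ((continuous_extendZero.comp continuous_fst).update k continuous_snd)
    obtain ⟨h1, -, h3, h4⟩ := hX.2 k hk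
      (BoundedContinuousFunction.ofNormedAddCommGroup _ hc 1 fun y => hbound _ _)
    simp only [BoundedContinuousFunction.coe_ofNormedAddCommGroup] at h1 h3 h4
    have e1 : (fun ω => U (k + 1) fun j => X j ω) = fun ω =>
        U (k + 1) (Function.update (extendZero fun j : Fin k => X j ω) k (X k ω)) := by
      funext ω
      refine hUcongr (k + 1) _ _ fun j hj => ?_
      rcases (Nat.lt_succ_iff.1 hj).eq_or_lt with h | h
      · rw [h, Function.update_self]
      · rw [Function.update_of_ne h.ne, extendZero_apply_of_lt (fun j => X j ω) h]
    rw [e1]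
    refine ⟨h1, ?_⟩
    rw [h4]
    calc _ ≤ 𝔼.E (fun ω => (U k fun j => X j ω) + e) := by
          refine 𝔼.mono _ h3 _ (add_const_mem ih1 e) fun ω => ?_
          refine (hid k (by omega) (extendZero fun j : Fin k => X j ω)).trans_eq ?_
          rw [hUcongr k _ (fun j => X j ω) fun j hj => extendZero_apply_of_lt (fun j => X j ω) hj]
      _ = 𝔼.E (fun ω => U k fun j => X j ω) + e := E_add_const ih1 e
      _ ≤ U 0 0 + (k + 1 : ℕ) * e := by
          push_cast
          linarith

end Iterate

/-! ### Truncated moments -/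

section Moments

variable {Ω : Type*} {𝔼 : SublinearExpectation Ω} {X₀ : Ω → ℝ}

/-- Normalizing by the lower deviation gives `ξ₀²` upper expectation at least 1, so quadratic
minorants yield lower bounds for moments. -/
lemma le_extE_of_quadratic_le (h : X₀ ∈ 𝔼.dom) (h2 : (fun ω => X₀ ω ^ 2) ∈ 𝔼.dom)
    (hσ : 0 < 𝔼.lowerSigma X₀) {μ : ℝ} (hμ : μ ∈ 𝔼.meanInterval X₀) {F : Ω → ℝ} {α β : ℝ}
    (hα : 0 ≤ α) (hF : ∀ ω, α * 𝔼.xi₀ X₀ μ ω ^ 2 + β ≤ F ω) :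
    ((α + β : ℝ) : EReal) ≤ 𝔼.extE F := by
  refine le_iInf₂ fun Z hZ => ?_
  obtain ⟨hZm, hZF⟩ := hZ
  rw [EReal.coe_le_coe_iff]
  have hY := sq_sub_mem h h2 μ
  set low := 𝔼.lowerE (fun ω => (X₀ ω - μ) ^ 2) with hlow
  have hpos : 0 < 𝔼.lowerSD X₀ μ := hσ.trans_le (lowerSigma_le_lowerSD hμ)
  have hlow0 : 0 < low := Real.sqrt_pos.1 hpos
  have hsq : 𝔼.lowerSD X₀ μ ^ 2 = low := Real.sq_sqrt hlow0.le
  have hQ : (fun ω => α / low * (X₀ ω - μ) ^ 2 + β) ∈ 𝔼.dom :=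
    add_const_mem (const_mul_mem hY _) β
  calc α + β ≤ α / low * 𝔼.E (fun ω => (X₀ ω - μ) ^ 2) + β := by
        have h3 : α = α / low * low := (div_mul_cancel₀ _ hlow0.ne').symm
        have h4 : α / low * low ≤ α / low * 𝔼.E (fun ω => (X₀ ω - μ) ^ 2) :=
          mul_le_mul_of_nonneg_left (lowerE_le_E hY) (by positivity)
        linarith
    _ = 𝔼.E (fun ω => α / low * (X₀ ω - μ) ^ 2 + β) := by
        rw [E_add_const (const_mul_mem hY _), E_const_mul hY (by positivity)]
    _ ≤ 𝔼.E Z := by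
        refine 𝔼.mono _ hQ _ hZm fun ω => le_trans (le_of_eq ?_) ((hF ω).trans (hZF ω))
        rw [xi₀, div_pow, hsq]
        ring

lemma extE_le_gammaTrunc {μ : ℝ} (hμ : μ ∈ 𝔼.meanInterval X₀) (p C : ℝ) :
    𝔼.extE (fun ω => min (|𝔼.xi₀ X₀ μ ω| ^ p) (C ^ (p - 2) * 𝔼.xi₀ X₀ μ ω ^ 2)) ≤
      𝔼.gammaTrunc X₀ p C :=
  le_iSup₂ (f := fun μ (_ : μ ∈ 𝔼.meanInterval X₀) =>
    𝔼.extE (fun ω => min (|𝔼.xi₀ X₀ μ ω| ^ p) (C ^ (p - 2) * 𝔼.xi₀ X₀ μ ω ^ 2))) μ hμ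

lemma gammaTrunc_le_gamma (p C : ℝ) : 𝔼.gammaTrunc X₀ p C ≤ 𝔼.gamma X₀ p :=
  iSup₂_mono fun _ _ => le_iInf₂ fun Z hZ =>
    iInf₂_le (f := fun (Z : Ω → ℝ) _ => ((𝔼.E Z : ℝ) : EReal)) Z
      ⟨hZ.1, fun ω => (min_le_left _ _).trans (hZ.2 ω)⟩

/-- Bernoulli's inequality for `(t²) ^ (p/2)` supplies the minorant `(p/2) t² - (p/2 - 1)`. It also
lies below the truncation because `p / 2 ≤ 2 ^ (p - 2) ≤ C ^ (p - 2)`. -/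
lemma one_le_gammaTrunc (h : X₀ ∈ 𝔼.dom) (h2 : (fun ω => X₀ ω ^ 2) ∈ 𝔼.dom)
    (hσ : 0 < 𝔼.lowerSigma X₀) {p C : ℝ} (hp : 2 ≤ p) (hC : 2 ≤ C) :
    1 ≤ 𝔼.gammaTrunc X₀ p C := by
  have hμ : 𝔼.E X₀ ∈ 𝔼.meanInterval X₀ := ⟨lowerE_le_E h, le_rfl⟩
  have e : ((p / 2 + -(p / 2 - 1) : ℝ) : EReal) = 1 := by
    rw [show p / 2 + -(p / 2 - 1) = 1 by ring, EReal.coe_one]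
  rw [← e]
  refine (le_extE_of_quadratic_le h h2 hσ hμ (by linarith) fun ω => le_min ?_ ?_).trans
    (extE_le_gammaTrunc hμ p C)
  · set t := 𝔼.xi₀ X₀ (𝔼.E X₀) ω
    have hb := one_add_mul_self_le_rpow_one_add (s := t ^ 2 - 1) (by linarith [sq_nonneg t])
      (p := p / 2) (by linarith)
    have ht : |t| ^ p = (t ^ 2) ^ (p / 2) := by
      rw [← sq_abs, ← Real.rpow_natCast, ← Real.rpow_mul (abs_nonneg t)]
      congr 1
      push_cast
      ring
    rw [ht]
    rw [add_sub_cancel] at hb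
    linarith
  · set t := 𝔼.xi₀ X₀ (𝔼.E X₀) ω
    have h3 : p / 2 ≤ C ^ (p - 2) := by
      calc p / 2 ≤ Real.log 2 * (p - 2) + 1 := by nlinarith [Real.log_two_gt_d9]
        _ ≤ Real.exp (Real.log 2 * (p - 2)) := Real.add_one_le_exp _
        _ = 2 ^ (p - 2) := (Real.rpow_def_of_pos two_pos _).symm
        _ ≤ C ^ (p - 2) := Real.rpow_le_rpow two_pos.le hC (by linarith)
    have := mul_le_mul_of_nonneg_right h3 (sq_nonneg t)
    linarith

/-- With `u = |t| / C`, both terms of the minimum dominate `u² - 4/27`, since `u² - u³` has maximum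
`4/27` at `2/3`. Finally `1/4 - 4/27 ≥ 1/10`. -/
lemma rpow_div_ten_le_gammaTrunc (h : X₀ ∈ 𝔼.dom) (h2 : (fun ω => X₀ ω ^ 2) ∈ 𝔼.dom)
    (hσ : 0 < 𝔼.lowerSigma X₀) {p C : ℝ} (hp2 : 2 ≤ p) (hp3 : p ≤ 3)
    (hC0 : 0 < C) (hC : C ≤ 2) : ((C ^ p / 10 : ℝ) : EReal) ≤ 𝔼.gammaTrunc X₀ p C := by
  have hμ : 𝔼.E X₀ ∈ 𝔼.meanInterval X₀ := ⟨lowerE_le_E h, le_rfl⟩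
  have hCp := Real.rpow_pos_of_pos hC0 p
  have hC2 : C ^ p / 10 ≤ C ^ p / C ^ 2 + -(C ^ p * (4 / 27)) := by
    have h3 : (1 : ℝ) / 4 ≤ 1 / C ^ 2 :=
      one_div_le_one_div_of_le (by positivity) (by nlinarith)
    have h4 : C ^ p / C ^ 2 = C ^ p * (1 / C ^ 2) := by ring
    rw [h4]
    nlinarith
  refine (EReal.coe_le_coe_iff.2 hC2).trans
    ((le_extE_of_quadratic_le h h2 hσ hμ (by positivity) fun ω => ?_).trans
      (extE_le_gammaTrunc hμ p C))
  set t := 𝔼.xi₀ X₀ (𝔼.E X₀) ω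
  rw [min_rpow_eq hC0]
  set u := |t| / C with hu
  have hu0 : 0 ≤ u := by positivity
  have e : C ^ p / C ^ 2 * t ^ 2 + -(C ^ p * (4 / 27)) = C ^ p * (u ^ 2 - 4 / 27) := by
    rw [hu, div_pow, sq_abs]
    ring
  rw [e]
  refine mul_le_mul_of_nonneg_left (le_min ?_ (by linarith)) hCp.le
  rcases hu0.eq_or_lt with h0 | h0
  · rw [← h0]
    have := Real.rpow_nonneg (le_refl (0 : ℝ)) p
    norm_num
    linarith
  · rcases le_total u 1 with h1 | h1
    · have h3 : u ^ 3 ≤ u ^ p := by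
        rw [← Real.rpow_natCast]
        exact Real.rpow_le_rpow_of_exponent_ge h0 h1 (by exact_mod_cast hp3)
      nlinarith [mul_nonneg (sq_nonneg (u - 2 / 3)) (by linarith : (0 : ℝ) ≤ u + 1 / 3)]
    · have h3 : u ^ 2 ≤ u ^ p := by
        rw [← Real.rpow_two]
        exact Real.rpow_le_rpow_of_exponent_le h1 hp2
      linarith

end Moments

end SublinearExpectation

/-! ### The remainder term in terms of truncated moments -/

/-- For exponents between 2 and 3, `min (v³) (v²) ≤ v ^ p`. The constant is `2/3 · (15/4)³`; the
quadratic branch needs only `2 · (15/4)²`, which is smaller. -/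
lemma taylor_remainder_le {C p y t : ℝ} (hC : 0 < C) (hp2 : 2 ≤ p) (hp3 : p ≤ 3) (hy : |y| ≤ |t|) :
    2 / 3 * min (|y / (4 * C / 15)| ^ 3) (3 * |y / (4 * C / 15)| ^ 2) ≤
      1125 / 32 / C ^ p * min (|t| ^ p) (C ^ (p - 2) * t ^ 2) := by
  have hCp := Real.rpow_pos_of_pos hC p
  rw [min_rpow_eq hC, ← mul_assoc, div_mul_cancel₀ _ hCp.ne']
  set v := |t| / C with hv
  have hu : |y / (4 * C / 15)| = 15 / 4 * (|y| / C) := by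
    rw [abs_div, abs_of_pos (by positivity : 0 < 4 * C / 15)]
    field_simp
  have huv : |y| / C ≤ v := div_le_div_of_nonneg_right hy hC.le
  have hu0 : 0 ≤ |y| / C := by positivity
  have hv0 : 0 ≤ v := hu0.trans huv
  rw [hu]
  have h3 : min (v ^ 3) (v ^ 2) ≤ v ^ p := by
    rcases hv0.eq_or_lt with h0 | h0
    · rw [← h0, Real.zero_rpow (by linarith)]
      norm_num
    · rcases le_total v 1 with h1 | h1
      · refine (min_le_left _ _).trans ?_
        rw [← Real.rpow_natCast]
        exact Real.rpow_le_rpow_of_exponent_ge h0 h1 (by exact_mod_cast hp3)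
      · refine (min_le_right _ _).trans ?_
        rw [← Real.rpow_two]
        exact Real.rpow_le_rpow_of_exponent_le h1 hp2
  calc 2 / 3 * min ((15 / 4 * (|y| / C)) ^ 3) (3 * (15 / 4 * (|y| / C)) ^ 2)
      ≤ 2 / 3 * min ((15 / 4 * v) ^ 3) (3 * (15 / 4 * v) ^ 2) := by gcongr
    _ ≤ 1125 / 32 * min (v ^ 3) (v ^ 2) := by
        rw [mul_min_of_nonneg _ _ (by norm_num), mul_min_of_nonneg _ _ (by norm_num)]
        refine min_le_min (le_of_eq (by ring)) ?_
        nlinarith [sq_nonneg v]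
    _ ≤ 1125 / 32 * min (v ^ p) (v ^ 2) := by
        exact mul_le_mul_of_nonneg_left (le_min h3 (min_le_right _ _)) (by norm_num)

/-! ### The quantitative estimate for the adaptive broken line -/

namespace SublinearExpectation

lemma mem_vertexSet_of_adaptiveLine {Ω : Type*} {X : ℕ → Ω → ℝ} {n : ℕ}
    {M V : ℕ → (ℕ → ℝ) → ℝ} {D : Set C(unitInterval, ℝ)} {ω : Ω}
    (h : adaptiveLine X n (fun i y => M i (standardizedSums M V i (extendZero y)))
      (fun i y => V i (standardizedSums M V i (extendZero y))) ω ∈ D) :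
    (fun j : Fin (n + 1) => standardizedSums M V n (fun j => X j ω) j) ∈ vertexSet n D := by
  refine ⟨?_, ?_⟩
  · change standardizedSums M V n (fun j => X j ω) 0 = 0
    rw [standardizedSums_apply_of_le (Nat.zero_le n)]
    rfl
  · convert h using 1
    unfold adaptiveLine
    congr 1
    funext i
    have e : standardizedSums M V i (extendZero fun j : Fin i => X j ω) =
        standardizedSums M V i (fun j => X j ω) :=
      standardizedSums_congr fun j hj => extendZero_apply_of_lt (fun j => X j ω) hj
    change standardizedSums M V n (fun j => X j ω) (i + 1)
      - standardizedSums M V n (fun j => X j ω) i = _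
    rw [standardizedSums_succ_sub i.2]
    simp only [e]

/-- The estimate of the rate of convergence with explicit error terms. -/
theorem exists_upperProb_le {Ω : Type*} (𝔼 : SublinearExpectation Ω) {X₀ : Ω → ℝ} {X : ℕ → Ω → ℝ}
    (hX₀ : X₀ ∈ 𝔼.dom) (hX₀sq : (fun ω => X₀ ω ^ 2) ∈ 𝔼.dom) (hσ : 0 < 𝔼.lowerSigma X₀)
    (hX : 𝔼.IsIIDWith X X₀) {Ω' : Type*} [MeasurableSpace Ω'] {P : Measure Ω'}
    {B : NNReal → Ω' → ℝ} (hB : IsBrownianReal B P) {n : ℕ} (hn : 1 ≤ n)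
    (D : Set C(unitInterval, ℝ)) {ε C : ℝ} (hC : 0 < C) (hCε : C = ε * √(n : ℝ)) :
    ∃ m s : (i : Fin n) → (Fin i → ℝ) → ℝ, 𝔼.IsAdmissible X₀ n m s ∧
      ∀ p ∈ Set.Icc (2 : ℝ) 3, ∀ g : ℝ, 𝔼.gammaTrunc X₀ p C ≤ (g : EReal) →
        𝔼.upperProb (fun ω (i : Fin n) => X i ω) {ω | adaptiveLine X n m s ω ∈ D} ≤
          P.real (pathEvent B (Metric.thickening ε D)) +
            n * (1125 / 32 / C ^ p * g + 58 / C ^ 3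
              + 2 * Real.exp (-(2 * (19 / 100 * C) ^ 2))) := by
  set W : NNReal → Ω' → ℝ := fun t ω => √(n : ℝ) * B (t / n) ω with hWdef
  have hWB : IsBrownianReal W P := isBrownianReal_rescale hB (by omega)
  have hW := hWB.toIsPreBrownianReal
  set S := vertexSet n D with hS
  -- Distance budget: `2κ + C/100 + 19C/100 = C` covers smoothing and tube, thickening, and bridges.
  -- The width `h` is the largest with `3h/2 ≤ κ`.
  set κ : ℝ := 2 / 5 * C with hκdef
  set h : ℝ := 4 * C / 15 with hh
  have hh0 : 0 < h := by positivity
  have hκ : 3 * h / 2 ≤ κ := by rw [hh, hκdef]; linarith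
  have hη : 0 < C / 100 := by positivity
  have hδ : 0 < 1 / C ^ 3 := by positivity
  -- The selection error `1 / C ^ 3` has the order of the Gaussian remainder. Nothing here involves
  -- `p`.
  choose M V hMc hVc hMmem hlowV hVup hsel using fun k : ℕ =>
    exists_selection hX₀ hX₀sq hσ (continuous_potentialSlope S κ hη hW h k)
      (continuous_potentialCurvature S κ hη hW h k) hδ
  have hV0 : ∀ k s, 0 < V k s := fun k s =>
    hσ.trans_le ((lowerSigma_le_lowerSD (hMmem k s)).trans (hlowV k s))
  have hsc : ∀ k, Continuous (standardizedSums M V k) := fun k =>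
    continuous_standardizedSums (n := k) (fun k _ => hMc k) (fun k _ => hVc k)
      (fun k _ s => (hV0 k s).ne') le_rfl
  refine ⟨fun i y => M i (standardizedSums M V i (extendZero y)),
    fun i y => V i (standardizedSums M V i (extendZero y)), ?_, ?_⟩
  · exact {
      continuous_m := fun i => (hMc i).comp ((hsc i).comp continuous_extendZero)
      continuous_s := fun i => (hVc i).comp ((hsc i).comp continuous_extendZero)
      m_mem := fun i x => hMmem _ _
      lowerSigma_pos := hσ
      lowerSigma_le := fun i x => lowerSigma_le_lowerSD (hMmem _ _)
      lowerSD_le := fun i x => hlowV _ _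
      le_upperSD := fun i x => hVup _ _
      upperSD_le := fun i x => upperSD_le_upperSigma hX₀ hX₀sq (hMmem _ _) }
  intro p hp g hg
  set U : ℕ → (ℕ → ℝ) → ℝ := fun k x =>
    tubePotential S κ hη W P h k (standardizedSums M V k x) with hU
  set e : ℝ := 16 / 15 / h ^ 3 + 1 / C ^ 3 + 1125 / 32 / C ^ p * g with he
  have hstep : ∀ k < n, ∀ x : ℕ → ℝ,
      (fun ω => U (k + 1) (Function.update x k (X₀ ω))) ∈ 𝔼.dom →
      𝔼.E (fun ω => U (k + 1) (Function.update x k (X₀ ω))) ≤ U k x + e := by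
    intro k _ x hdom
    set s := standardizedSums M V k x with hs
    obtain ⟨hQ, hQδ⟩ := hsel k s
    have hμ := hMmem k s
    have hle := E_le_of_le_add_extE hdom hQ (A := 1125 / 32 / C ^ p) (c := U k x + 16 / 15 / h ^ 3)
      (div_nonneg (by norm_num) (Real.rpow_nonneg hC.le p)) ((extE_le_gammaTrunc hμ p C).trans hg)
      hQδ fun ω => ?_
    · rw [he]
      linarith
    · have e1 : standardizedSums M V k (Function.update x k (X₀ ω)) = s :=
        standardizedSums_congr fun j hj => Function.update_of_ne hj.ne _ _
      have h1 := tubePotential_succ_le S hη hW hh0 hκ k s ((X₀ ω - M k s) / V k s)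
      -- The chosen deviation is at least the lower one, so the increment is dominated by `ξ₀` at
      -- the same mean.
      have h2 : |(X₀ ω - M k s) / V k s| ≤ |𝔼.xi₀ X₀ (M k s) ω| := by
        rw [xi₀, abs_div, abs_div]
        refine div_le_div_of_nonneg_left (abs_nonneg _) ?_ ?_
        · exact abs_pos.2 (hσ.trans_le (lowerSigma_le_lowerSD hμ)).ne'
        · rw [abs_of_pos (hV0 k s), abs_of_nonneg (hσ.le.trans (lowerSigma_le_lowerSD hμ))]
          exact hlowV k s
      have h3 := taylor_remainder_le hC hp.1 hp.2 h2
      rw [← hh] at h3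
      simp only [hU, standardizedSums, e1, Function.update_self]
      linarith
  have hiter := E_iterate_le hX (n := n) (U := U) (e := e)
    (fun k _ => (continuous_tubePotential S κ hη hW h k).comp (hsc k))
    (fun k x => tubePotential_mem_Icc S κ hη hW h k _)
    (fun k x x' hxx => by simp only [hU, standardizedSums_congr hxx]) hstep hn le_rfl
  have hext : ∀ ω, U n (extendZero fun i : Fin n => X i ω) = U n fun j => X j ω := fun ω => by
    simp only [hU]
    rw [standardizedSums_congr fun j hj => extendZero_apply_of_lt (fun j => X j ω) hj]
  have hup : 𝔼.upperProb (fun ω (i : Fin n) => X i ω)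
      {ω | adaptiveLine X n (fun i y => M i (standardizedSums M V i (extendZero y)))
        (fun i y => V i (standardizedSums M V i (extendZero y))) ω ∈ D} ≤
      𝔼.E (fun ω => U n fun j => X j ω) := by
    refine csInf_le ⟨0, ?_⟩ ⟨fun y => U n (extendZero y), ?_, fun ω => ?_, ?_⟩
    · rintro r ⟨ψ, hψ, hA, rfl⟩
      exact E_nonneg hψ fun ω => (Set.indicator_nonneg (fun _ _ => zero_le_one) ω).trans (hA ω)
    · simp only [hext]
      exact hiter.1
    · change _ ≤ U n (extendZero fun i : Fin n => X i ω)
      rw [hext]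
      by_cases hω : ω ∈ {ω | adaptiveLine X n
          (fun i y => M i (standardizedSums M V i (extendZero y)))
          (fun i y => V i (standardizedSums M V i (extendZero y))) ω ∈ D}
      · rw [Set.indicator_of_mem hω]
        exact (tubePotential_last S hη hW hh0 hκ (mem_vertexSet_of_adaptiveLine hω)).ge
      · rw [Set.indicator_of_notMem hω]
        exact (tubePotential_mem_Icc S κ hη hW h n _).1
    · simp only [hext]
  have h0 : U 0 0 ≤ P.real {ω | ∃ x ∈ S, ∀ j : Fin (n + 1),
      |W ((j : ℕ) : NNReal) ω - x j| < 2 * κ + C / 100} :=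
    tubePotential_zero_le S hη hW hh0 hκ rfl
  have hsk := measureReal_skeleton_le hB hn D (ε := ε) (x := 19 / 100 * C)
    (c := 2 * κ + C / 100) (by positivity) (by rw [← hCε, hκdef]; linarith)
  have hnum : 16 / 15 / h ^ 3 + 1 / C ^ 3 ≤ 58 / C ^ 3 := by
    have : 16 / 15 / h ^ 3 = 225 / 4 / C ^ 3 := by
      rw [hh]
      field_simp
      norm_num
    rw [this, ← add_div]
    gcongr
    norm_num
  have hn0 : (0 : ℝ) ≤ n := Nat.cast_nonneg n
  calc _ ≤ U 0 0 + n * e := hup.trans hiter.2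
    _ ≤ P.real (pathEvent B (Metric.thickening ε D))
        + n * (2 * Real.exp (-(2 * (19 / 100 * C) ^ 2))) + n * e := by
        have := h0.trans hsk
        linarith
    _ ≤ _ := by
        rw [add_assoc, ← mul_add]
        refine add_le_add le_rfl (mul_le_mul_of_nonneg_left ?_ hn0)
        rw [he]
        linarith

end SublinearExpectation

/-! ### Constants -/

/-- The bound 90 fits since `1125/32 + 58 + 90 < 184`. -/
lemma two_mul_cube_mul_exp_le {C : ℝ} (hC : 0 ≤ C) :
    2 * C ^ 3 * Real.exp (-(2 * (19 / 100 * C) ^ 2)) ≤ 90 := by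
  set y := 2 * (19 / 100 * C) ^ 2 with hy
  have hy0 : 0 ≤ y := by positivity
  rw [Real.exp_neg, ← div_eq_mul_inv, div_le_iff₀ (Real.exp_pos _)]
  refine le_trans ?_ (mul_le_mul_of_nonneg_left (Real.quadratic_le_exp_of_nonneg hy0)
    (by norm_num))
  rw [hy]
  nlinarith [mul_nonneg (sq_nonneg C) (sq_nonneg (C - 4)), sq_nonneg C]

/-- For this range the exponent exceeds 5; factoring out `exp 5 ≥ 148` sharpens the quadratic bound.
The value 10 fits under the smallest value `4.7³` of the constant. -/
lemma two_mul_cube_mul_exp_le_of_large {C : ℝ} (hC : 87 / 10 ≤ C) :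
    2 * C ^ 3 * Real.exp (-(2 * (19 / 100 * C) ^ 2)) ≤ 10 := by
  set y := 2 * (19 / 100 * C) ^ 2 with hy
  have hz : 0 ≤ y - 5 := by
    rw [hy]
    nlinarith
  rw [Real.exp_neg, ← div_eq_mul_inv, div_le_iff₀ (Real.exp_pos _)]
  have h5 : (148 : ℝ) ≤ Real.exp 5 := by
    have : Real.exp 5 = Real.exp 1 ^ 5 := by
      rw [← Real.exp_nat_mul]
      norm_num
    rw [this]
    exact le_trans (by norm_num) (pow_le_pow_left₀ (by norm_num) Real.exp_one_gt_d9.le 5)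
  have he : Real.exp y = Real.exp 5 * Real.exp (y - 5) := by
    rw [← Real.exp_add]
    congr 1
    ring
  have h6 : 148 * (1 + (y - 5) + (y - 5) ^ 2 / 2) ≤ Real.exp y := by
    rw [he]
    exact mul_le_mul h5 (Real.quadratic_le_exp_of_nonneg hz) (by positivity) (Real.exp_pos _).le
  refine le_trans ?_ (mul_le_mul_of_nonneg_left h6 (by norm_num))
  obtain ⟨d, hd0, rfl⟩ : ∃ d : ℝ, 0 ≤ d ∧ C = 87 / 10 + d := ⟨C - 87 / 10, by linarith, by ring⟩
  rw [hy]
  have h2 := pow_nonneg hd0 2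
  have h3 := pow_nonneg hd0 3
  have h4 := pow_nonneg hd0 4
  nlinarith

lemma le_constC₂ {p : ℝ} (hp : 2 ≤ p) : 207 / 2 ≤ constC₂ p := by
  refine le_min (by norm_num) ?_
  calc (207 / 2 : ℝ) ≤ 4.7 ^ (3 : ℝ) := by
        rw [show (3 : ℝ) = ((3 : ℕ) : ℝ) by norm_num, Real.rpow_natCast]
        norm_num
    _ ≤ 4.7 ^ (p + 1) := Real.rpow_le_rpow_of_exponent_le (by norm_num) (by linarith)

/-- In the nontrivial range the constant `C₂(p)` absorbs all error terms. -/
lemma error_terms_le_constC₂ {p C : ℝ} (hp2 : 2 ≤ p) (hC0 : 0 < C)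
    (hC : constC₂ p < C ^ p) :
    1125 / 32 + 58 + 2 * C ^ 3 * Real.exp (-(2 * (19 / 100 * C) ^ 2)) ≤ constC₂ p := by
  rcases min_choice (184 : ℝ) ((4.7 : ℝ) ^ (p + 1)) with h | h
  · rw [constC₂, h]
    linarith [two_mul_cube_mul_exp_le hC0.le]
  · have h184 : (4.7 : ℝ) ^ (p + 1) ≤ 184 := min_eq_right_iff.1 h
    -- When the power is the smaller term, `p` is small because `4.7 ^ (7/2) > 184`.
    have hp5 : p ≤ 5 / 2 := by
      by_contra hlt
      have h1 : (4.7 : ℝ) ^ (7 / 2 : ℝ) ≤ 184 :=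
        (Real.rpow_le_rpow_of_exponent_le (by norm_num) (by linarith)).trans h184
      have h2 : ((4.7 : ℝ) ^ (7 / 2 : ℝ)) ^ 2 = 4.7 ^ 7 := by
        rw [← Real.rpow_natCast, ← Real.rpow_mul (by norm_num), ← Real.rpow_natCast]
        norm_num
      have h3 := pow_le_pow_left₀ (Real.rpow_nonneg (by norm_num) _) h1 2
      rw [h2] at h3
      norm_num at h3
    -- Otherwise `C ^ p ≤ 4.7 ^ p · (87/47) ^ (5/2) ≤ 4.7 ^ (p + 1)`, against the hypothesis.
    have hC87 : 87 / 10 ≤ C := by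
      by_contra hlt
      have h1 : C ^ p ≤ (87 / 10) ^ p := Real.rpow_le_rpow hC0.le (by linarith) (by linarith)
      have h2 : (87 / 10 : ℝ) ^ p = 4.7 ^ p * (87 / 47) ^ p := by
        rw [← Real.mul_rpow (by norm_num) (by norm_num)]
        norm_num
      have h3 : (87 / 47 : ℝ) ^ p ≤ 4.7 := by
        refine (Real.rpow_le_rpow_of_exponent_le (by norm_num) hp5).trans ?_
        refine (sq_le_sq₀ (by positivity) (by norm_num)).1 ?_
        rw [← Real.rpow_natCast, ← Real.rpow_mul (by norm_num),
          show (5 / 2 * ((2 : ℕ) : ℝ)) = ((5 : ℕ) : ℝ) by norm_num, Real.rpow_natCast]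
        norm_num
      have h4 : constC₂ p = 4.7 ^ p * 4.7 := by
        rw [constC₂, h, Real.rpow_add_one (by norm_num)]
      have h5 := mul_le_mul_of_nonneg_left h3 (Real.rpow_nonneg (by norm_num : (0 : ℝ) ≤ 4.7) p)
      linarith
    linarith [two_mul_cube_mul_exp_le_of_large hC87, le_constC₂ hp2]

theorem theorem2p1 {Ω : Type*} (𝔼 : SublinearExpectation Ω)
    (X₀ : Ω → ℝ) (X : ℕ → Ω → ℝ)
    (hX₀ : X₀ ∈ 𝔼.dom) (hX₀sq : (fun ω => X₀ ω ^ 2) ∈ 𝔼.dom)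
    (hσ : 0 < 𝔼.lowerSigma X₀)
    (hX : 𝔼.IsIIDWith X X₀)
    {Ω' : Type*} [MeasurableSpace Ω'] (P : MeasureTheory.Measure Ω')
    (B : NNReal → Ω' → ℝ) (hB : ProbabilityTheory.IsBrownianReal B P)
    (n : ℕ) (hn : 1 ≤ n) (D : Set C(unitInterval, ℝ)) (ε : ℝ) (hε : 0 < ε) :
    ∃ m s : (i : Fin n) → (Fin i → ℝ) → ℝ,
      𝔼.IsAdmissible X₀ n m s ∧
      ∀ p ∈ Set.Icc (2 : ℝ) 3,
        ((𝔼.upperProb (fun ω (i : Fin n) => X i ω) {ω | adaptiveLine X n m s ω ∈ D}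
            - P.real (pathEvent B (Metric.thickening ε D)) : ℝ) : EReal)
          ≤ ((constC₂ p / ((n : ℝ) ^ ((p - 2) / 2) * ε ^ p) : ℝ) : EReal)
              * 𝔼.gammaTrunc X₀ p (ε * √(n : ℝ)) ∧
        ((constC₂ p / ((n : ℝ) ^ ((p - 2) / 2) * ε ^ p) : ℝ) : EReal)
              * 𝔼.gammaTrunc X₀ p (ε * √(n : ℝ))
          ≤ ((constC₂ p / ((n : ℝ) ^ ((p - 2) / 2) * ε ^ p) : ℝ) : EReal)
              * 𝔼.gamma X₀ p := by
  have hn0 : (0 : ℝ) < n := by exact_mod_cast hn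
  set C := ε * √(n : ℝ) with hCdef
  have hC : 0 < C := mul_pos hε (Real.sqrt_pos.2 hn0)
  obtain ⟨m, s, hadm, hmain⟩ :=
    𝔼.exists_upperProb_le hX₀ hX₀sq hσ hX hB hn D hC hCdef
  refine ⟨m, s, hadm, fun p hp => ?_⟩
  have hK := le_constC₂ hp.1
  have hCp : 0 < C ^ p := Real.rpow_pos_of_pos hC p
  have hcoef : constC₂ p / ((n : ℝ) ^ ((p - 2) / 2) * ε ^ p) = constC₂ p * n / C ^ p := by
    have h1 : C ^ p = ε ^ p * (n : ℝ) ^ (p / 2) := by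
      rw [hCdef, Real.mul_rpow hε.le (Real.sqrt_nonneg _), Real.sqrt_eq_rpow,
        ← Real.rpow_mul hn0.le]
      congr 2
      ring
    have h2 : (n : ℝ) ^ (p / 2) = (n : ℝ) ^ ((p - 2) / 2) * n := by
      rw [← Real.rpow_add_one hn0.ne']
      congr 1
      ring
    have h3 := Real.rpow_pos_of_pos hε p
    have h4 := Real.rpow_pos_of_pos hn0 ((p - 2) / 2)
    rw [h1, h2]
    field_simp
  rw [hcoef]
  set c := constC₂ p * n / C ^ p with hc
  have hc0 : 0 < c := by positivity
  refine ⟨?_, mul_le_mul_of_nonneg_left (SublinearExpectation.gammaTrunc_le_gamma p C)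
    (by exact_mod_cast hc0.le)⟩
  have hdiff1 : 𝔼.upperProb (fun ω (i : Fin n) => X i ω) {ω | adaptiveLine X n m s ω ∈ D}
      - P.real (pathEvent B (Metric.thickening ε D)) ≤ 1 := by
    have h1 := SublinearExpectation.upperProb_le_one (𝔼 := 𝔼) (fun ω (i : Fin n) => X i ω)
      {ω | adaptiveLine X n m s ω ∈ D}
    have h2 : 0 ≤ P.real (pathEvent B (Metric.thickening ε D)) := measureReal_nonneg
    linarith
  have hn1 : (1 : ℝ) ≤ n := by exact_mod_cast hn
  -- The lower bound for the truncated moment excludes `⊥` and makes the right-hand side at least 1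
  -- whenever `C < 2` or `C ^ p ≤ C₂(p) n`; there the claim is trivial.
  have hγ0 : ∃ r : ℝ, (r : EReal) ≤ 𝔼.gammaTrunc X₀ p C ∧ 0 ≤ r ∧
      (C < 2 → r = C ^ p / 10) ∧ (2 ≤ C → r = 1) := by
    rcases lt_or_ge C 2 with h | h
    · exact ⟨C ^ p / 10, SublinearExpectation.rpow_div_ten_le_gammaTrunc hX₀ hX₀sq hσ hp.1 hp.2 hC
        h.le, by positivity, fun _ => rfl, fun h' => absurd h' (not_le.2 h)⟩
    · exact ⟨1, by simpa using SublinearExpectation.one_le_gammaTrunc hX₀ hX₀sq hσ hp.1 h,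
        zero_le_one, fun h' => absurd h (not_le.2 h'), fun _ => rfl⟩
  obtain ⟨r, hr, hr0, hr1, hr2⟩ := hγ0
  induction hγ : 𝔼.gammaTrunc X₀ p C using EReal.rec with
  | bot =>
    rw [hγ] at hr
    exact absurd (le_bot_iff.1 hr) (EReal.coe_ne_bot r)
  | top =>
    rw [EReal.coe_mul_top_of_pos hc0]
    exact le_top
  | coe g =>
    rw [hγ, EReal.coe_le_coe_iff] at hr
    rw [← EReal.coe_mul, EReal.coe_le_coe_iff]
    rcases lt_or_ge C 2 with h2 | h2
    · refine hdiff1.trans ?_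
      rw [hr1 h2] at hr
      calc (1 : ℝ) ≤ constC₂ p * n / 10 := by nlinarith
        _ = c * (C ^ p / 10) := by
            rw [hc]
            field_simp
        _ ≤ c * g := by gcongr
    · rw [hr2 h2] at hr
      rcases le_or_gt (C ^ p) (constC₂ p * n) with h3 | h3
      · refine hdiff1.trans ?_
        have : 1 ≤ c := (one_le_div hCp).2 h3
        nlinarith
      · have hKC : constC₂ p < C ^ p := lt_of_le_of_lt (by nlinarith) h3
        have hnum := error_terms_le_constC₂ hp.1 hC hKC
        have hle := hmain p hp g hγ.le
        have hpC : C ^ p ≤ C ^ 3 := by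
          rw [← Real.rpow_natCast]
          exact Real.rpow_le_rpow_of_exponent_le (by linarith) (by exact_mod_cast hp.2)
        set E := Real.exp (-(2 * (19 / 100 * C) ^ 2)) with hE
        have hE0 : 0 < E := Real.exp_pos _
        -- Errors free of moments are absorbed using `C ^ p ≤ C ^ 3` and `g ≥ 1`.
        have h5 : 58 / C ^ 3 + 2 * E ≤ (58 + 2 * C ^ 3 * E) / C ^ p * g := by
          calc 58 / C ^ 3 + 2 * E = (58 + 2 * C ^ 3 * E) / C ^ 3 := by field_simp
            _ ≤ (58 + 2 * C ^ 3 * E) / C ^ p := by gcongr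
            _ ≤ _ := le_mul_of_one_le_right (by positivity) hr
        have h6 : 1125 / 32 / C ^ p * g + (58 + 2 * C ^ 3 * E) / C ^ p * g ≤
            constC₂ p / C ^ p * g := by
          rw [← add_mul, ← add_div]
          gcongr
          linarith
        have h7 : n * (1125 / 32 / C ^ p * g + 58 / C ^ 3 + 2 * E) ≤
            n * (constC₂ p / C ^ p * g) := mul_le_mul_of_nonneg_left (by linarith) hn0.le
        have h8 : n * (constC₂ p / C ^ p * g) = c * g := by
          rw [hc]
          ring
        linarith
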